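/- Let $k$ be a finite field and let $K_0(\mathcal{V}_k)$ be the Grothendieck ring of $k$-varieties, where a $k$-variety is a separated scheme of finite type over $k$: as an additive group it is generated by the isomorphism classes $[X]$ of $k$-varieties $X$, subject to the relations $[A]=[A\setminus B]+[B]$ for every closed subscheme $B$ of a $k$-variety $A$, and its product is given by $[U]\cdot[V]=[U\times_{\mathrm{Spec}(k)}V]$, so that $1=[\mathrm{Spec}(k)]$. Let $\mathbb{L}=[\mathbb{A}^1_k]$, and let $\mathbb{Z}[\mathbb{L}]\subseteq K_0(\mathcal{V}_k)$ be the subring generated by $\mathbb{L}$. Let $n\geq 1$, let $f\in k[x_0,\dots,x_n]$ be a nonzero homogeneous polynomial of degree $2$ (not necessarily irreducible or nondegenerate), and let $\mathcal{Q}_n=\mathrm{Proj}\big(k[x_0,\dots,x_n]/(f)\big)$ be the quadric hypersurface in $\mathbb{P}^n_k$ that it defines. Then there exists a field extension $K/k$ of degree at most $2$ such that $[\mathcal{Q}_n]$ lies in the $\mathbb{Z}[\mathbb{L}]$-submodule of $K_0(\mathcal{V}_k)$ generated by $1$ and $[\mathrm{Spec}(K)]$. -/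

import Mathlib

universe u

open CategoryTheory AlgebraicGeometry MonoidalCategory

namespace GrothendieckRing

/-! ### Varieties over a field and their Grothendieck ring -/

section K0

variable (k : Type u) [Field k]

/-- The property of a `k`-scheme of being separated and of finite type over `k`.
Reducedness and irreducibility are not required. -/
def isVariety : ObjectProperty (Over (Spec (.of k))) := fun X =>
  IsSeparated X.hom ∧ LocallyOfFiniteType X.hom ∧ QuasiCompact X.hom

/-- Varieties are stable under the fibre product over `Spec k`, and `Spec k` is a variety. -/
instance isVariety_isMonoidal : (isVariety k).IsMonoidal where
  prop_unit := by
    change IsSeparated (𝟙 (Spec (.of k))) ∧ LocallyOfFiniteType (𝟙 (Spec (.of k))) ∧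
      QuasiCompact (𝟙 (Spec (.of k)))
    exact ⟨inferInstance, inferInstance, inferInstance⟩
  prop_tensor := by
    rintro X Y ⟨_, _, _⟩ ⟨_, _, _⟩
    refine ⟨?_, ?_, ?_⟩ <;> (rw [Over.tensorObj_hom]; infer_instance)

/-- The category `𝒱_k` of `k`-varieties: a full subcategory of the category of `k`-schemes, with
all `k`-morphisms, and with the fibre product over `Spec k` as monoidal structure. -/
abbrev Variety : Type (u + 1) := (isVariety k).FullSubcategory

/-- The monoid of isomorphism classes of `k`-varieties, where the product of the classes of `X`
and `Y` is the class of `X ×_k Y`, and the unit is the class of `Spec k`. -/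
abbrev IsoClasses : Type (u + 1) := Skeleton (Variety k)

/-- The free abelian group on the isomorphism classes of `k`-varieties, with the product
`[U] * [V] = [U ×_k V]` on generators extended bilinearly. -/
abbrev FreeRing : Type (u + 1) := MonoidAlgebra ℤ (IsoClasses k)

variable {k}

/-- The generator of the free abelian group that belongs to a variety. -/
noncomputable def gen (X : Variety k) : FreeRing k := MonoidAlgebra.of ℤ _ (toSkeleton X)

variable (k)

/-- The elements `[A] - [A ∖ B] - [B]`, for a variety `A`, a closed subscheme `B` of `A` and the
open complement `A ∖ B`. -/
def scissor : Set (FreeRing k) :=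
  {x | ∃ (A B U : Variety k) (i : B ⟶ A) (j : U ⟶ A),
    IsClosedImmersion i.hom.left ∧ IsOpenImmersion j.hom.left ∧
    Set.range j.hom.left = (Set.range i.hom.left)ᶜ ∧
    x = gen A - gen U - gen B}

/-- The Grothendieck ring `K₀(𝒱_k)` of `k`-varieties. -/
abbrev K0 : Type (u + 1) := FreeRing k ⧸ Ideal.span (scissor k)

variable {k}

/-- The class `[X]` of a `k`-variety `X` in `K₀(𝒱_k)`. -/
noncomputable def cls (X : Variety k) : K0 k := Ideal.Quotient.mk _ (gen X)

variable (k)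

/-- The affine line over `k`. -/
noncomputable def affineLine : Variety k where
  obj := Over.mk (𝔸(PUnit.{u + 1}; Spec (.of k)) ↘ Spec (.of k))
  property := by
    refine ⟨?_, ?_, ?_⟩ <;> (dsimp only [Over.mk_hom]; infer_instance)

/-- The class `𝕃` of the affine line in `K₀(𝒱_k)`. -/
noncomputable def lefschetz : K0 k := cls (affineLine k)

/-- The subring `ℤ[𝕃]` of `K₀(𝒱_k)`. -/
noncomputable abbrev ZL : Subalgebra ℤ (K0 k) := Algebra.adjoin ℤ {lefschetz k}

/-- The variety `Spec A` over `k`, for a `k`-algebra `A` of finite type. -/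
noncomputable def specVariety (A : Type u) [CommRing A] [Algebra k A] [Algebra.FiniteType k A] :
    Variety k where
  obj := Over.mk (Spec.map (CommRingCat.ofHom (algebraMap k A)))
  property := by
    change IsSeparated (Spec.map (CommRingCat.ofHom (algebraMap k A))) ∧
      LocallyOfFiniteType (Spec.map (CommRingCat.ofHom (algebraMap k A))) ∧
      QuasiCompact (Spec.map (CommRingCat.ofHom (algebraMap k A)))
    refine ⟨inferInstance, ?_, inferInstance⟩
    rw [HasRingHomProperty.Spec_iff (P := @LocallyOfFiniteType)]
    exact RingHom.finiteType_algebraMap.mpr inferInstance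

end K0

/-! ### Closed subschemes of projective space as `Proj` of a quotient of the polynomial ring -/

section Quotient

variable {k A : Type u} [Field k] [CommRing A] [Algebra k A]
  (𝒜 : ℕ → Submodule k A) [GradedAlgebra 𝒜] (I : HomogeneousIdeal 𝒜)

/-- The grading of the quotient of a graded algebra by a homogeneous ideal: the part of degree `d`
is the image of the part of degree `d`. -/
def quotientGrading (d : ℕ) : Submodule k (A ⧸ I.toIdeal) :=
  (𝒜 d).map (Ideal.Quotient.mkₐ k I.toIdeal).toLinearMap

/-- The quotient map in degree `d`. -/
def quotientGradingMap (d : ℕ) : 𝒜 d →ₗ[k] quotientGrading 𝒜 I d :=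
  (Ideal.Quotient.mkₐ k I.toIdeal).toLinearMap.restrict fun _ hx => Submodule.mem_map_of_mem hx

instance quotientGrading_gradedMonoid : SetLike.GradedMonoid (quotientGrading 𝒜 I) where
  one_mem := ⟨1, SetLike.GradedOne.one_mem, by simp⟩
  mul_mem := by
    rintro i j _ _ ⟨a, ha, rfl⟩ ⟨b, hb, rfl⟩
    exact ⟨a * b, SetLike.GradedMul.mul_mem ha hb, by simp⟩

/-- The map that takes an element to the images of its homogeneous parts in the quotient. -/
noncomputable def preDecompose : A →ₗ[k] DirectSum ℕ fun d => quotientGrading 𝒜 I d :=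
  DirectSum.lmap (quotientGradingMap 𝒜 I) ∘ₗ (DirectSum.decomposeLinearEquiv 𝒜).toLinearMap

theorem preDecompose_apply (x : A) (d : ℕ) :
    preDecompose 𝒜 I x d = quotientGradingMap 𝒜 I d (DirectSum.decompose 𝒜 x d) :=
  DirectSum.lmap_apply _ _ _

theorem preDecompose_eq_zero (x : A) (hx : x ∈ I.toIdeal) : preDecompose 𝒜 I x = 0 := by
  refine DFinsupp.ext fun d => Subtype.ext ?_
  have h : Ideal.Quotient.mk I.toIdeal (DirectSum.decompose 𝒜 x d) = 0 :=
    Ideal.Quotient.eq_zero_iff_mem.mpr (I.isHomogeneous d hx)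
  exact (congrArg Subtype.val (preDecompose_apply 𝒜 I x d)).trans h

/-- Decomposition of an element of the quotient into homogeneous parts: decompose a
representative. -/
noncomputable def quotientDecompose :
    (A ⧸ I.toIdeal) →ₗ[k] DirectSum ℕ fun d => quotientGrading 𝒜 I d where
  toFun := Quotient.lift (preDecompose 𝒜 I) fun a b hab => by
    have h := preDecompose_eq_zero 𝒜 I _ ((Submodule.quotientRel_def _).mp hab)
    calc preDecompose 𝒜 I a = preDecompose 𝒜 I ((a - b) + b) := by rw [sub_add_cancel]
      _ = preDecompose 𝒜 I b := by rw [map_add, h, zero_add]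
  map_add' := by
    rintro ⟨a⟩ ⟨b⟩
    exact map_add (preDecompose 𝒜 I) a b
  map_smul' := by
    rintro c ⟨a⟩
    exact map_smul (preDecompose 𝒜 I) c a

theorem quotientDecompose_mk {d : ℕ} (a : 𝒜 d) :
    quotientDecompose 𝒜 I (Ideal.Quotient.mk I.toIdeal a) =
      DirectSum.lof k ℕ (fun d => quotientGrading 𝒜 I d) d (quotientGradingMap 𝒜 I d a) := by
  change DirectSum.lmap (quotientGradingMap 𝒜 I) (DirectSum.decompose 𝒜 (a : A)) = _
  rw [DirectSum.decompose_coe]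
  exact DirectSum.lmap_lof _ _ _

noncomputable instance quotientGradedAlgebra : GradedAlgebra (quotientGrading 𝒜 I) :=
  { toDecomposition := DirectSum.Decomposition.ofLinearMap _ (quotientDecompose 𝒜 I)
      (by
        apply LinearMap.ext
        intro y
        obtain ⟨x, rfl⟩ := Ideal.Quotient.mk_surjective y
        rw [LinearMap.comp_apply, LinearMap.id_apply]
        induction x using DirectSum.Decomposition.inductionOn 𝒜 with
        | zero => simp
        | homogeneous a =>
          rw [quotientDecompose_mk, DirectSum.coeLinearMap_lof]
          rfl
        | add a b ha hb => rw [map_add, map_add, map_add, ha, hb])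
      (by
        refine DirectSum.linearMap_ext _ fun d => LinearMap.ext ?_
        rintro ⟨_, a, ha, rfl⟩
        rw [LinearMap.comp_apply, LinearMap.comp_apply, DirectSum.coeLinearMap_lof]
        exact quotientDecompose_mk 𝒜 I ⟨a, ha⟩) }

/-- The structure map `Proj B ⟶ Spec B₀ ⟶ Spec k` for the quotient `B` of a graded `k`-algebra by a
homogeneous ideal. -/
noncomputable def projToSpec :
    Proj (quotientGrading 𝒜 I) ⟶ Spec (.of k) :=
  Proj.toSpecZero (quotientGrading 𝒜 I) ≫
    Spec.map (CommRingCat.ofHom (algebraMap k (quotientGrading 𝒜 I 0)))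

end Quotient

section Quadric

variable {k : Type u} [Field k] {n : ℕ}

/-- The grading of `k[x₀, …, xₙ]` by degree. -/
abbrev polyGrading (k : Type u) [Field k] (n : ℕ) : ℕ → Submodule k (MvPolynomial (Fin (n + 1)) k) :=
  MvPolynomial.homogeneousSubmodule (Fin (n + 1)) k

noncomputable instance polyGrading_gradedAlgebra : GradedAlgebra (polyGrading k n) :=
  MvPolynomial.gradedAlgebra

/-- The homogeneous ideal generated by a form of degree `d`. -/
noncomputable def formIdeal {d : ℕ} (f : MvPolynomial (Fin (n + 1)) k) (hf : f.IsHomogeneous d) :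
    HomogeneousIdeal (polyGrading k n) where
  toSubmodule := Ideal.span {f}
  is_homogeneous' := Ideal.homogeneous_span _ _ (by
    rintro _ rfl
    exact ⟨d, hf⟩)

theorem algebraMap_quotientGrading_zero_surjective (I : HomogeneousIdeal (polyGrading k n)) :
    Function.Surjective (algebraMap k (quotientGrading (polyGrading k n) I 0)) := by
  rintro ⟨_, a, ha, rfl⟩
  obtain ⟨c, rfl⟩ : ∃ c, a = MvPolynomial.C c :=
    ⟨_, MvPolynomial.totalDegree_eq_zero_iff_eq_C.mp (Nat.le_zero.mp ha.totalDegree_le)⟩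
  exact ⟨c, Subtype.ext rfl⟩

/-- The quadric hypersurface `Proj (k[x₀, …, xₙ] / (f))` in `ℙⁿ` over `k` with equation `f = 0`,
where `f` is a form of degree `2`. -/
noncomputable def quadric (f : MvPolynomial (Fin (n + 1)) k) (hf : f.IsHomogeneous 2) :
    Variety k where
  obj := Over.mk (projToSpec (polyGrading k n) (formIdeal f hf))
  property := by
    have hs := algebraMap_quotientGrading_zero_surjective (formIdeal f hf)
    have : IsClosedImmersion (Spec.map (CommRingCat.ofHom
        (algebraMap k (quotientGrading (polyGrading k n) (formIdeal f hf) 0)))) :=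
      IsClosedImmersion.spec_of_surjective _ hs
    have : IsScalarTower k (quotientGrading (polyGrading k n) (formIdeal f hf) 0)
        (MvPolynomial (Fin (n + 1)) k ⧸ (formIdeal f hf).toIdeal) :=
      ⟨fun c x y => smul_mul_assoc c (x : MvPolynomial (Fin (n + 1)) k ⧸ (formIdeal f hf).toIdeal) y⟩
    have : Algebra.FiniteType (quotientGrading (polyGrading k n) (formIdeal f hf) 0)
        (MvPolynomial (Fin (n + 1)) k ⧸ (formIdeal f hf).toIdeal) :=
      Algebra.FiniteType.of_restrictScalars_finiteType k
        (quotientGrading (polyGrading k n) (formIdeal f hf) 0) _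
    change IsSeparated (projToSpec _ _) ∧ LocallyOfFiniteType (projToSpec _ _) ∧
      QuasiCompact (projToSpec _ _)
    unfold projToSpec
    exact ⟨inferInstance, inferInstance, inferInstance⟩

end Quadric

end GrothendieckRing

/-! The form `f` plays no role in the choice of `K`: a finite field has exactly one quadratic
extension up to isomorphism, and that one is always taken. Let `specSpan` be the `ℤ[𝕃]`-module
generated by `1` and `[Spec K]`.

Projective space is the disjoint union of the cells where the `i`-th coordinate is the first nonzero
one. Normalizing that coordinate to `1` makes the cell an affine space of dimension `n - i`, in
which the quadric becomes the zero set of a polynomial of degree at most `2`. By the scissor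
relations (`cls_mem_of_forall_closed`, `cls_cell_eq`) it suffices to treat affine quadrics `g = 0`
in `𝔸ᵐ`. This is `affineQuadricsMem`, by strong induction on `m`.

If the quadratic part of `g` has a nontrivial zero, a linear change of coordinates turns the
equation into `N x + h = 0`, with `N` and `h` free of `x`, `deg N ≤ 1` and `deg h ≤ 2`. Where `N ≠
0` this is a graph; over `N = 0` it is a line times `N = h = 0`. Hence `affCls_linear`, whose terms
are all quadrics in fewer variables. For `m ≥ 3` the Chevalley–Warning theorem provides the zero.

For `m = 2` the quadratic part may be anisotropic, but Chevalley–Warning applied to the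
homogenization of `g` then gives an affine rational point. With that point at the origin, the
blow-up `(x, t) ↦ (x, t x)` again makes the equation linear in `x` (`affCls_conic_mem`).

For `m ≤ 1` what remains is a line or the spectrum of an algebra of dimension at most `2`, which
decomposes into copies of `Spec k` or is `Spec K` (`affCls_mem_of_finrank_le_two`). -/

namespace GrothendieckRing

/-! ### Scissor calculus in the Grothendieck ring. -/

section Classes

variable {k : Type u} [Field k]

theorem cls_congr {X Y : Variety k} (e : X ≅ Y) : cls X = cls Y := by
  have : toSkeleton X = toSkeleton Y := Quotient.sound ⟨e⟩
  simp only [cls, gen, this]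

theorem cls_scissor {A B U : Variety k} (i : B ⟶ A) (j : U ⟶ A) (hi : IsClosedImmersion i.hom.left)
    (hj : IsOpenImmersion j.hom.left)
    (h : Set.range j.hom.left = (Set.range i.hom.left)ᶜ) : cls A = cls U + cls B := by
  have h1 : gen A - gen U - gen B ∈ Ideal.span (scissor k) :=
    Ideal.subset_span ⟨A, B, U, i, j, hi, hj, h, rfl⟩
  rw [← Ideal.Quotient.eq_zero_iff_mem, map_sub, map_sub] at h1
  rw [sub_sub, sub_eq_zero] at h1
  exact h1

theorem cls_tensor (X Y : Variety k) : cls (X ⊗ Y) = cls X * cls Y := by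
  simp only [cls, gen, Skeleton.toSkeleton_tensorObj]
  rw [← map_mul]
  congr 1
  exact (MonoidAlgebra.of ℤ _).map_mul _ _

theorem cls_unit : cls (𝟙_ (Variety k)) = 1 := by
  simp only [cls, gen, ← Skeleton.one_eq]
  exact congrArg _ (MonoidAlgebra.of ℤ _).map_one

/-- A scheme with a quasi-compact immersion into a variety is a variety. -/
noncomputable abbrev subvariety (X : Variety k) {Z : Scheme.{u}} (i : Z ⟶ X.obj.left) [IsImmersion i]
    [QuasiCompact i] : Variety k where
  obj := Over.mk (i ≫ X.obj.hom)
  property := by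
    obtain ⟨_, _, _⟩ := X.property
    refine ⟨?_, ?_, ?_⟩ <;> (dsimp only [Over.mk_hom]; infer_instance)

noncomputable abbrev subvarietyHom (X : Variety k) {Z : Scheme.{u}} (i : Z ⟶ X.obj.left)
    [IsImmersion i] [QuasiCompact i] : subvariety X i ⟶ X :=
  ObjectProperty.homMk (Over.homMk i)

instance isNoetherian_left (X : Variety k) : IsNoetherian X.obj.left := by
  obtain ⟨_, _, _⟩ := X.property
  have : IsLocallyNoetherian X.obj.left := LocallyOfFiniteType.isLocallyNoetherian X.obj.hom
  have : CompactSpace X.obj.left := QuasiCompact.compactSpace_of_compactSpace X.obj.hom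
  exact {}

theorem cls_eq_zero (X : Variety k) (h : IsEmpty X.obj.left) : cls X = 0 := by
  -- For empty `X` the identity is both the closed part and its open complement, so `[X] = [X] +
  -- [X]`.
  have := cls_scissor (𝟙 X) (𝟙 X) (by dsimp; infer_instance) (by dsimp; infer_instance)
    (Set.ext fun x => h.elim x)
  simpa using this

/-- Closed subvarieties with the same underlying set have the same class. -/
theorem cls_eq_of_range_eq {X T T' : Variety k} (i : T ⟶ X) (i' : T' ⟶ X)
    (hi : IsClosedImmersion i.hom.left) (hi' : IsClosedImmersion i'.hom.left)
    (h : Set.range i.hom.left = Set.range i'.hom.left) : cls T = cls T' := by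
  let U : X.obj.left.Opens := ⟨(Set.range i.hom.left)ᶜ,
    i.hom.left.isClosedEmbedding.isClosed_range.isOpen_compl⟩
  have hU : Set.range (subvarietyHom X U.ι).hom.left = (Set.range i.hom.left)ᶜ := by
    dsimp
    exact Scheme.Opens.range_ι U
  have h1 := cls_scissor i (subvarietyHom X U.ι) hi (inferInstanceAs (IsOpenImmersion U.ι)) hU
  have h2 := cls_scissor i' (subvarietyHom X U.ι) hi' (inferInstanceAs (IsOpenImmersion U.ι))
    (by rw [hU, h])
  exact add_left_cancel (h1.symm.trans h2)

/-- An ordered open cover stratifies `X` by the points of `U i` that lie in no earlier member. `T`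
ranges over all closed subschemes with this underlying set, so that no scheme structure has to be
fixed. The induction removes `U 0` and continues on its closed complement. -/
theorem cls_mem_of_forall_closed (M : AddSubgroup (K0 k)) {r : ℕ} (X : Variety k)
    (U : Fin r → Variety k) (j : ∀ i, U i ⟶ X) (hj : ∀ i, IsOpenImmersion (j i).hom.left)
    (hcov : ∀ x : X.obj.left, ∃ i, x ∈ Set.range (j i).hom.left)
    (hT : ∀ (i : Fin r) (T : Variety k) (t : T ⟶ U i), IsClosedImmersion t.hom.left →
      Set.range t.hom.left =
        {u | ∀ i' < i, (j i).hom.left u ∉ Set.range (j i').hom.left} → cls T ∈ M) :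
    cls X ∈ M := by
  induction r generalizing X with
  | zero =>
    rw [cls_eq_zero X ⟨fun x => (hcov x).choose.elim0⟩]
    exact M.zero_mem
  | succ r ih =>
    have hj0 := hj 0
    let C : TopologicalSpace.Closeds X.obj.left := ⟨(Set.range (j 0).hom.left)ᶜ,
      (j 0).hom.left.isOpenEmbedding.isOpen_range.isClosed_compl⟩
    -- The complement of `U 0` with its reduced structure.
    let ι := (Scheme.IdealSheafData.vanishingIdeal C).subschemeι
    have hι : Set.range ι = (Set.range (j 0).hom.left)ᶜ := by
      rw [Scheme.IdealSheafData.range_subschemeι]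
      simp [C]
    have h0 := cls_scissor (subvarietyHom X ι) (j 0) (inferInstanceAs (IsClosedImmersion ι)) hj0
      (by
        change _ = (Set.range ι)ᶜ
        rw [hι, compl_compl])
    rw [h0]
    refine M.add_mem (hT 0 (U 0) (𝟙 _) (by dsimp; infer_instance) ?_) ?_
    · ext u
      simp
    -- The remaining opens are intersected with the complement; `p` is closed in `U i.succ`, `q` is
    -- open in the complement.
    let p (i : Fin r) := Limits.pullback.fst (j i.succ).hom.left ι
    let q (i : Fin r) := Limits.pullback.snd (j i.succ).hom.left ι
    have hpq (i : Fin r) : p i ≫ (j i.succ).hom.left = q i ≫ ι := Limits.pullback.condition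
    have hpq' (i : Fin r) (u) : (j i.succ).hom.left (p i u) = ι (q i u) := by
      rw [← Scheme.Hom.comp_apply, hpq, Scheme.Hom.comp_apply]
    have hrange (i : Fin r) (z) : z ∈ Set.range (q i) ↔ ι z ∈ Set.range (j i.succ).hom.left := by
      have := hj i.succ
      have h := IsOpenImmersion.range_pullbackSnd (j i.succ).hom.left ι
      change Set.range (q i) = _ at h
      rw [h]
      rfl
    refine ih (subvariety X ι) (fun i => subvariety (U i.succ) (p i))
      (fun i => ObjectProperty.homMk (Over.homMk (q i) ?_)) ?_ ?_ ?_
    · have := Over.w (j i.succ).hom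
      dsimp at this ⊢
      rw [← this, reassoc_of% hpq]
    · intro i
      have := hj i.succ
      exact inferInstanceAs (IsOpenImmersion (Limits.pullback.snd (j i.succ).hom.left ι))
    · intro z
      obtain ⟨i, hi⟩ := hcov (ι z)
      obtain rfl | ⟨i, rfl⟩ := i.eq_zero_or_eq_succ
      · have : ι z ∈ (Set.range (j 0).hom.left)ᶜ := hι ▸ Set.mem_range_self z
        exact absurd hi this
      · exact ⟨i, (hrange i z).mpr hi⟩
    · intro i T t ht htr
      -- A stratum for the restricted cover is closed in `U i.succ` as well, and is the stratum of
      -- index `i.succ` there: lying in the complement means avoiding `U 0`.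
      refine hT i.succ T (t ≫ subvarietyHom (U i.succ) (p i)) ?_ ?_
      · have : IsClosedImmersion (t.hom.left ≫ p i) := inferInstance
        exact this
      · change Set.range (t.hom.left ≫ p i) = _
        have hcomp : Set.range (t.hom.left ≫ p i) = p i '' Set.range t.hom.left := by
          rw [← Set.range_comp]
          exact congrArg Set.range (funext fun _ => Scheme.Hom.comp_apply _ _ _)
        rw [hcomp, htr]
        ext u
        constructor
        · rintro ⟨v, hv, rfl⟩ i' hi'
          rw [hpq']
          obtain rfl | ⟨i', rfl⟩ := i'.eq_zero_or_eq_succ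
          · exact hι.subset ⟨q i v, rfl⟩
          · exact fun h => hv i' (Fin.succ_lt_succ_iff.mp hi') ((hrange i' _).mpr h)
        · intro hu
          obtain ⟨z, hz⟩ := hι.superset (hu 0 (Fin.succ_pos i))
          obtain ⟨v, hv, hv'⟩ := Scheme.Pullback.exists_preimage_pullback u z hz.symm
          refine ⟨v, fun i' hi' h => hu i'.succ (Fin.succ_lt_succ_iff.mpr hi') ?_, hv⟩
          have h3 := (hrange i' _).mp h
          change ι (q i v) ∈ _ at h3
          rw [← hpq'] at h3
          change (j i.succ).hom.left (p i v) ∈ _ at h3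
          rwa [show p i v = u from hv] at h3

end Classes

/-! ### Maps of `k`-algebras out of a localization at one element. -/

section Away

variable {k A B : Type u} [Field k] [CommRing A] [Algebra k A] [CommRing B] [Algebra k B]

noncomputable def awayLift (a : A) (f : A →ₐ[k] B) (h : IsUnit (f a)) :
    Localization.Away a →ₐ[k] B :=
  IsLocalization.liftAlgHom (M := Submonoid.powers a) (f := f) (by
    rintro ⟨_, n, rfl⟩
    simpa using h.pow n)

@[simp]
theorem awayLift_algebraMap (a : A) (f : A →ₐ[k] B) (h : IsUnit (f a)) (x : A) :
    awayLift a f h (algebraMap A _ x) = f x :=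
  IsLocalization.lift_eq _ _

theorem awayHom_ext {a : A} {f g : Localization.Away a →ₐ[k] B}
    (h : ∀ x, f (algebraMap A _ x) = g (algebraMap A _ x)) : f = g :=
  IsLocalization.algHom_ext (Submonoid.powers a) (AlgHom.ext h)

end Away

/-! ### Classes of affine varieties and of hypersurfaces linear in one variable. -/

section Affine

open TensorProduct

variable {k : Type u} [Field k]

noncomputable abbrev specHom {A B : Type u} [CommRing A] [Algebra k A] [Algebra.FiniteType k A]
    [CommRing B] [Algebra k B] [Algebra.FiniteType k B] (φ : A →ₐ[k] B) :
    specVariety k B ⟶ specVariety k A :=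
  ObjectProperty.homMk (Over.homMk (Spec.map (CommRingCat.ofHom φ.toRingHom)) (by
    change Spec.map _ ≫ Spec.map _ = Spec.map _
    rw [← Spec.map_comp, ← CommRingCat.ofHom_comp]
    congr 2
    exact φ.comp_algebraMap))

variable (k) in
/-- The class of `Spec A` in the Grothendieck ring, for a `k`-algebra `A` of finite type. -/
noncomputable def affCls (A : Type u) [CommRing A] [Algebra k A] [Algebra.FiniteType k A] : K0 k :=
  cls (specVariety k A)

variable {A B C : Type u} [CommRing A] [Algebra k A] [Algebra.FiniteType k A]
  [CommRing B] [Algebra k B] [Algebra.FiniteType k B]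
  [CommRing C] [Algebra k C] [Algebra.FiniteType k C]

theorem affCls_congr (e : A ≃ₐ[k] B) : affCls k A = affCls k B := by
  refine cls_congr ((isVariety k).isoMk (Over.isoMk
    (Scheme.Spec.mapIso e.toRingEquiv.toCommRingCatIso.symm.op) ?_))
  change Spec.map _ ≫ Spec.map _ = Spec.map _
  rw [← Spec.map_comp]
  congr 1
  ext x
  exact e.symm.commutes x

theorem affCls_of_subsingleton [Subsingleton A] : affCls k A = 0 :=
  cls_eq_zero _ (inferInstanceAs (IsEmpty (PrimeSpectrum A)))

theorem affCls_self : affCls k k = 1 := by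
  rw [← cls_unit]
  refine cls_congr ((isVariety k).isoMk (Over.isoMk (Iso.refl _) ?_))
  change 𝟙 _ ≫ 𝟙 _ = Spec.map _
  simp [Algebra.algebraMap_self]

theorem affCls_eq_one (e : A ≃ₐ[k] k) : affCls k A = 1 :=
  (affCls_congr e).trans affCls_self

theorem affCls_scissor (a : A) (φ : A →ₐ[k] B) (hφ : Function.Surjective φ)
    (hker : RingHom.ker φ = Ideal.span {a}) [Algebra A C] [IsScalarTower k A C]
    [IsLocalization.Away a C] : affCls k A = affCls k C + affCls k B := by
  refine cls_scissor (specHom φ) (specHom (IsScalarTower.toAlgHom k A C)) ?_ ?_ ?_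
  · exact IsClosedImmersion.spec_of_surjective _ hφ
  · exact IsOpenImmersion.of_isLocalization (S := C) a
  · change Set.range (PrimeSpectrum.comap (algebraMap A C)) =
      (Set.range (PrimeSpectrum.comap φ.toRingHom))ᶜ
    rw [PrimeSpectrum.localization_away_comap_range C a,
      range_comap_of_surjective _ _ hφ]
    change _ = (PrimeSpectrum.zeroLocus (RingHom.ker φ : Set A))ᶜ
    rw [hker, PrimeSpectrum.zeroLocus_span, PrimeSpectrum.basicOpen_eq_zeroLocus_compl]

instance finiteType_tensorProduct : Algebra.FiniteType k (A ⊗[k] B) :=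
  Algebra.FiniteType.trans (S := A) inferInstance inferInstance

theorem affCls_tensorProduct : affCls k (A ⊗[k] B) = affCls k A * affCls k B := by
  rw [affCls, affCls, affCls, ← cls_tensor]
  refine cls_congr ((isVariety k).isoMk (Over.isoMk (pullbackSpecIso k A B).symm ?_))
  change (pullbackSpecIso k A B).inv ≫ Limits.pullback.fst _ _ ≫ Spec.map _ = Spec.map _
  rw [pullbackSpecIso_inv_fst_assoc, ← Spec.map_comp]
  rfl

theorem lefschetz_eq : lefschetz k = affCls k (Polynomial k) := by
  rw [← affCls_congr (MvPolynomial.uniqueAlgEquiv k PUnit.{u + 1})]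
  refine cls_congr ((isVariety k).isoMk (Over.isoMk (AffineSpace.SpecIso PUnit (.of k)) ?_))
  change (AffineSpace.SpecIso PUnit (.of k)).hom ≫ Spec.map _ =
    𝔸(PUnit.{u + 1}; Spec (.of k)) ↘ Spec (.of k)
  rw [← Iso.eq_inv_comp, AffineSpace.SpecIso_inv_over]
  rfl

theorem affCls_polynomial : affCls k (Polynomial A) = lefschetz k * affCls k A := by
  rw [lefschetz_eq, mul_comm, ← affCls_tensorProduct]
  exact affCls_congr (polyEquivTensor k A)

theorem affCls_eq_away_add (a : A) :
    affCls k A = affCls k (Localization.Away a) + affCls k (A ⧸ Ideal.span {a}) :=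
  affCls_scissor a (Ideal.Quotient.mkₐ k (Ideal.span {a})) Ideal.Quotient.mk_surjective
    (Ideal.Quotient.mkₐ_ker k _)

/-- Mutually inverse birational maps, defined on `a ≠ 0` and `b ≠ 0`, identify these two open sets.
-/
theorem affCls_away_eq (a : A) (b : B) (α : A →ₐ[k] Localization.Away b)
    (β : B →ₐ[k] Localization.Away a) (hα : IsUnit (α a)) (hβ : IsUnit (β b))
    (h₁ : ∀ x, awayLift b β hβ (α x) = algebraMap A _ x)
    (h₂ : ∀ y, awayLift a α hα (β y) = algebraMap B _ y) :
    affCls k (Localization.Away a) = affCls k (Localization.Away b) :=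
  affCls_congr (AlgEquiv.ofAlgHom (awayLift a α hα) (awayLift b β hβ)
    (awayHom_ext fun y => by simpa using h₂ y) (awayHom_ext fun x => by simpa using h₁ x))

/-- The class of the hypersurface `N X + h = 0` in `𝔸¹ × Spec R`. -/
theorem affCls_linear (R : Type u) [CommRing R] [Algebra k R] [Algebra.FiniteType k R] (N h : R) :
    affCls k (Polynomial R ⧸ Ideal.span {Polynomial.C N * Polynomial.X + Polynomial.C h}) =
      affCls k R - affCls k (R ⧸ Ideal.span {N}) +
        lefschetz k * affCls k (R ⧸ Ideal.span {N, h}) := by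
  set g := Polynomial.C N * Polynomial.X + Polynomial.C h with hg
  set A := Polynomial R ⧸ Ideal.span {g} with hA
  set J : Ideal R := Ideal.span {N, h} with hJ
  let a : A := Ideal.Quotient.mk _ (Polynomial.C N)
  have hN : (Ideal.Quotient.mk J N) = 0 :=
    Ideal.Quotient.eq_zero_iff_mem.mpr (Ideal.subset_span (by simp))
  have hh : (Ideal.Quotient.mk J h) = 0 :=
    Ideal.Quotient.eq_zero_iff_mem.mpr (Ideal.subset_span (by simp))
  let π : Polynomial R →ₐ[k] Polynomial (R ⧸ J) := Polynomial.mapAlgHom (Ideal.Quotient.mkₐ k J)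
  have hπ : ∀ p ∈ Ideal.span {g}, π p = 0 := by
    intro p hp
    obtain ⟨q, rfl⟩ := Ideal.mem_span_singleton'.mp hp
    rw [map_mul, hg]
    simp [π, hN, hh]
  let φ : A →ₐ[k] Polynomial (R ⧸ J) := Ideal.Quotient.liftₐ _ π hπ
  have hφ : Function.Surjective φ := Ideal.Quotient.lift_surjective_of_surjective _ _
    (Polynomial.map_surjective _ Ideal.Quotient.mk_surjective)
  have hker : RingHom.ker φ = Ideal.span {a} := by
    apply le_antisymm
    · intro x hx
      obtain ⟨p, rfl⟩ := Ideal.Quotient.mk_surjective x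
      have hp : p ∈ RingHom.ker (Polynomial.mapRingHom (Ideal.Quotient.mk J)) := hx
      rw [Polynomial.ker_mapRingHom, Ideal.mk_ker, hJ, Ideal.map_span, Set.image_pair,
        Ideal.mem_span_pair] at hp
      obtain ⟨u, v, rfl⟩ := hp
      -- Modulo `g` one has `h = -N X`, so `u N + v h = (u - v X) N` and `N` alone generates the
      -- kernel.
      refine Ideal.mem_span_singleton'.mpr ⟨Ideal.Quotient.mk _ (u - v * Polynomial.X), ?_⟩
      rw [← map_mul, Ideal.Quotient.mk_eq_mk_iff_sub_mem]
      refine Ideal.mem_span_singleton'.mpr ⟨-v, ?_⟩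
      rw [hg]
      ring
    · rw [Ideal.span_singleton_le_iff_mem]
      change Polynomial.map _ (Polynomial.C N) = 0
      simp [hN]
  have h1 : affCls k A = _ + _ := affCls_scissor a φ hφ hker (C := Localization.Away a)
  rw [h1, affCls_polynomial, affCls_eq_away_add (k := k) N, add_sub_cancel_right]
  congr 1
  -- Where `N` is invertible the equation is solved by `X = -h / N`.
  let α₀ : Polynomial R →ₐ[R] Localization.Away N :=
    Polynomial.aeval (-(algebraMap R _ h * IsLocalization.Away.invSelf N))
  have hα₀ : ∀ p ∈ Ideal.span {g}, α₀.restrictScalars k p = 0 := by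
    intro p hp
    obtain ⟨q, rfl⟩ := Ideal.mem_span_singleton'.mp hp
    have h1 := IsLocalization.Away.mul_invSelf (S := Localization.Away N) N
    have h2 : α₀ g = 0 := by
      rw [hg]
      simp only [α₀, map_add, map_mul, Polynomial.aeval_C, Polynomial.aeval_X]
      linear_combination (-algebraMap R (Localization.Away N) h) * h1
    rw [map_mul, AlgHom.restrictScalars_apply, AlgHom.restrictScalars_apply, h2, mul_zero]
  let α : A →ₐ[k] Localization.Away N := Ideal.Quotient.liftₐ _ (α₀.restrictScalars k) hα₀
  have hα (p : Polynomial R) : α (Ideal.Quotient.mk _ p) = α₀ p := rfl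
  let γ : A →ₐ[k] Localization.Away a := IsScalarTower.toAlgHom k A (Localization.Away a)
  let ρ : R →ₐ[k] A := (Ideal.Quotient.mkₐ k _).comp Polynomial.CAlgHom
  have hαa : α a = algebraMap R _ N := by
    rw [hα]
    simp [α₀]
  have hβN : (γ.comp ρ) N = algebraMap A _ a := rfl
  have hua : IsUnit (α a) := hαa ▸ IsLocalization.Away.algebraMap_isUnit N
  have huN : IsUnit ((γ.comp ρ) N) := hβN ▸ IsLocalization.Away.algebraMap_isUnit a
  refine affCls_away_eq a N α (γ.comp ρ) hua huN ?_ ?_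
  · have key : ((awayLift N (γ.comp ρ) huN).comp α).comp (Ideal.Quotient.mkₐ k _) =
        γ.comp (Ideal.Quotient.mkₐ k _) := by
      apply Polynomial.algHom_ext'
      · ext r
        change awayLift N (γ.comp ρ) huN (α₀ (Polynomial.C r)) = _
        simp only [α₀, Polynomial.aeval_C, awayLift_algebraMap]
        rfl
      · change awayLift N (γ.comp ρ) huN (α₀ Polynomial.X) =
          algebraMap A _ (Ideal.Quotient.mk _ Polynomial.X)
        -- After multiplication by the unit `N` both sides become `-h`.
        refine huN.mul_left_cancel ?_
        rw [← awayLift_algebraMap N (γ.comp ρ) huN N, ← map_mul]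
        have h1 := IsLocalization.Away.mul_invSelf (S := Localization.Away N) N
        have h2 : algebraMap R (Localization.Away N) N * α₀ Polynomial.X =
            algebraMap R _ (-h) := by
          simp only [α₀, Polynomial.aeval_X, map_neg]
          linear_combination (-algebraMap R (Localization.Away N) h) * h1
        rw [h2, awayLift_algebraMap, awayLift_algebraMap]
        change algebraMap A (Localization.Away a) (Ideal.Quotient.mk _ (Polynomial.C (-h))) =
          algebraMap A _ a * algebraMap A _ (Ideal.Quotient.mk _ Polynomial.X)
        rw [← map_mul, ← map_mul]
        congr 1
        rw [Ideal.Quotient.mk_eq_mk_iff_sub_mem]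
        refine Ideal.mem_span_singleton'.mpr ⟨-1, ?_⟩
        rw [hg, map_neg]
        ring
    intro x
    obtain ⟨p, rfl⟩ := Ideal.Quotient.mk_surjective x
    exact DFunLike.congr_fun key p
  · intro r
    change awayLift a α hua (algebraMap A _ (Ideal.Quotient.mk _ (Polynomial.C r))) = _
    rw [awayLift_algebraMap, hα]
    simp [α₀]

end Affine

/-! ### The target module, and finite algebras of dimension at most two. -/

section QuadraticModule

variable (k K : Type u) [Field k] [Field K] [Algebra k K] [Module.Finite k K]

/-- The `ℤ[𝕃]`-submodule of `K₀(𝒱_k)` generated by `1` and `[Spec K]`. -/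
noncomputable def specSpan : Submodule (ZL k) (K0 k) := Submodule.span (ZL k) {1, affCls k K}

variable {k K}

theorem one_mem_specSpan : (1 : K0 k) ∈ specSpan k K := Submodule.subset_span (by simp)

theorem affCls_mem_specSpan : affCls k K ∈ specSpan k K := Submodule.subset_span (by simp)

theorem lefschetz_mul_mem {x : K0 k} (hx : x ∈ specSpan k K) : lefschetz k * x ∈ specSpan k K :=
  (specSpan k K).smul_mem ⟨lefschetz k, Algebra.subset_adjoin rfl⟩ hx

variable [Finite k] (hK : Module.finrank k K = 2)

include hK

/-- A nonzero nonunit `a` splits the class into those of `A_a` and `A / a`, both of smaller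
dimension. If there is none and `A ≠ 0`, then `A` is a field of degree `1` or `2` over `k`. -/
theorem affCls_mem_of_finrank_le_two (A : Type u) [CommRing A] [Algebra k A] [Module.Finite k A]
    (h : Module.finrank k A ≤ 2) : affCls k A ∈ specSpan k K := by
  induction hd : Module.finrank k A using Nat.strong_induction_on generalizing A with
  | _ d ih =>
  by_cases hA : Subsingleton A
  · rw [affCls_of_subsingleton]
    exact Submodule.zero_mem _
  rw [not_subsingleton_iff_nontrivial] at hA
  by_cases hu : ∃ a : A, a ≠ 0 ∧ ¬ IsUnit a
  · obtain ⟨a, ha0, hau⟩ := hu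
    -- Over an Artinian ring a localization is a quotient, so `A_a` is finite over `k`; equal
    -- dimensions would make `A → A_a` bijective and `a` a unit.
    have : IsArtinianRing A := .of_finite k A
    have hsurj : Function.Surjective (algebraMap A (Localization.Away a)) :=
      IsArtinianRing.localization_surjective (Submonoid.powers a) _
    let γ : A →ₐ[k] Localization.Away a := IsScalarTower.toAlgHom k A (Localization.Away a)
    have hfin : Module.Finite k (Localization.Away a) :=
      Module.Finite.of_surjective γ.toLinearMap hsurj
    have hlt : Module.finrank k (Localization.Away a) < d := by
      refine lt_of_le_of_ne (hd ▸ γ.toLinearMap.finrank_le_finrank_of_surjective hsurj) fun he => ?_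
      have hinj : Function.Injective γ.toLinearMap :=
        (LinearMap.injective_iff_surjective_of_finrank_eq_finrank (hd.trans he.symm)).mpr hsurj
      have hγ : IsUnit (γ a) := IsLocalization.Away.algebraMap_isUnit a
      exact hau ((MulEquiv.isUnit_map (RingEquiv.ofBijective γ ⟨hinj, hsurj⟩)).mp hγ)
    have hlt' : Module.finrank k (A ⧸ Ideal.span {a}) < d := by
      have h1 := Submodule.finrank_quotient_add_finrank ((Ideal.span {a}).restrictScalars k)
      have h2 : 0 < Module.finrank k ((Ideal.span {a}).restrictScalars k) := by
        rw [Module.finrank_pos_iff]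
        exact ⟨⟨⟨a, Ideal.mem_span_singleton_self a⟩, 0, fun h => ha0 (congrArg Subtype.val h)⟩⟩
      rw [hd] at h1
      change Module.finrank k (A ⧸ (Ideal.span {a}).restrictScalars k) < d
      omega
    rw [affCls_eq_away_add a]
    exact Submodule.add_mem _ (ih _ hlt _ (by omega) rfl) (ih _ hlt' _ (by omega) rfl)
  · push Not at hu
    let _ : Field A := (IsField.mk ⟨0, 1, zero_ne_one⟩ mul_comm
      fun {a} ha => (hu a ha).exists_right_inv).toField
    have hpos : 0 < Module.finrank k A := Module.finrank_pos
    obtain h1 | h2 : Module.finrank k A = 1 ∨ Module.finrank k A = 2 := by omega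
    · rw [affCls_eq_one (AlgEquiv.ofBijective (Algebra.ofId k A)
        (Algebra.finrank_eq_one_iff_bijective_algebraMap.mp h1)).symm]
      exact one_mem_specSpan
    · obtain ⟨p, hp⟩ := CharP.exists k
      have : Fact p.Prime := ⟨CharP.char_is_prime k p⟩
      -- Uniqueness of the quadratic extension of a finite field.
      rw [affCls_congr ((FiniteField.algEquivExtension k p 2 A h2).trans
        (FiniteField.algEquivExtension k p 2 K hK).symm)]
      exact affCls_mem_specSpan

theorem affCls_univariate_mem (g : Polynomial k) (hg : g.natDegree ≤ 2) :
    affCls k (Polynomial k ⧸ Ideal.span {g}) ∈ specSpan k K := by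
  by_cases h0 : g = 0
  · subst h0
    rw [affCls_congr ((Ideal.quotientEquivAlgOfEq k Ideal.span_singleton_zero).trans
      (AlgEquiv.quotientBot k (Polynomial k))), affCls_polynomial, affCls_self]
    exact lefschetz_mul_mem one_mem_specSpan
  · have : Module.Finite k (Polynomial k ⧸ Ideal.span {g}) :=
      (AdjoinRoot.powerBasis h0).finite
    refine affCls_mem_of_finrank_le_two hK _ ?_
    rwa [finrank_quotient_span_eq_natDegree]

end QuadraticModule

/-! ### Zeros of forms, and linear changes of variables. -/

section Polynomials

open MvPolynomial

variable {k : Type u} [Field k]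

theorem totalDegree_aeval_le {σ τ : Type*} (w : σ → MvPolynomial τ k)
    (hw : ∀ i, (w i).totalDegree ≤ 1) (p : MvPolynomial σ k) :
    (aeval w p).totalDegree ≤ p.totalDegree := by
  rw [aeval_def, eval₂_eq]
  refine totalDegree_finsetSum_le fun m hm => ?_
  refine (totalDegree_mul _ _).trans ?_
  rw [algebraMap_eq, totalDegree_C, zero_add]
  refine (totalDegree_finsetProd _ _).trans (le_trans ?_ (le_totalDegree hm))
  refine Finset.sum_le_sum fun i _ => (totalDegree_pow _ _).trans ?_
  exact (Nat.mul_le_mul_left _ (hw i)).trans (mul_one _).le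

theorem aeval_mul_of_isHomogeneous {σ B : Type*} [CommRing B] [Algebra k B] {F : MvPolynomial σ k}
    {d : ℕ} (hF : F.IsHomogeneous d) (x : B) (w : σ → B) :
    aeval (fun i => x * w i) F = x ^ d * aeval w F := by
  rw [aeval_def, aeval_def, eval₂_eq, eval₂_eq, Finset.mul_sum]
  refine Finset.sum_congr rfl fun m hm => ?_
  have hd : ∑ i ∈ m.support, m i = d := by
    have := hF (mem_support_iff.mp hm)
    simpa [Finsupp.weight_apply, Finsupp.sum] using this
  simp_rw [mul_pow]
  rw [Finset.prod_mul_distrib, Finset.prod_pow_eq_pow_sum, hd]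
  ring

theorem eq_sum_homogeneousComponent {σ : Type*} {d : ℕ} {g : MvPolynomial σ k}
    (hg : g.totalDegree ≤ d) : g = ∑ i ∈ Finset.range (d + 1), homogeneousComponent i g := by
  conv_lhs => rw [← sum_homogeneousComponent g]
  refine Finset.sum_subset (Finset.range_mono (by omega)) fun i _ hi => ?_
  exact homogeneousComponent_eq_zero _ _ (by simpa using hi)

/-- Restriction to the line through `0` and `v` separates the homogeneous parts by powers of the
parameter. -/
theorem coeff_aeval_C_mul_X {σ : Type*} (g : MvPolynomial σ k) (v : σ → k) (d : ℕ) :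
    (aeval (fun i => Polynomial.C (v i) * Polynomial.X) g).coeff d =
      eval v (homogeneousComponent d g) := by
  have h : ∀ i, aeval (fun i => Polynomial.C (v i) * Polynomial.X) (homogeneousComponent i g) =
      Polynomial.X ^ i * Polynomial.C (eval v (homogeneousComponent i g)) := by
    intro i
    have h1 := aeval_mul_of_isHomogeneous (homogeneousComponent_isHomogeneous i g)
      (Polynomial.X : Polynomial k) (fun i => Polynomial.C (v i))
    simp_rw [mul_comm (Polynomial.C _), h1]
    congr 1
    rw [← coe_aeval_eq_eval]
    exact aeval_algebraMap_apply (Polynomial k) v (homogeneousComponent i g)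
  conv_lhs => rw [eq_sum_homogeneousComponent (le_max_left g.totalDegree d)]
  rw [map_sum, Polynomial.finsetSum_coeff, Finset.sum_eq_single d]
  · rw [h, mul_comm, Polynomial.coeff_C_mul, Polynomial.coeff_X_pow_self, mul_one]
  · intro i _ hi
    rw [h, mul_comm, Polynomial.coeff_C_mul, Polynomial.coeff_X_pow, if_neg hi.symm, mul_zero]
  · intro hd
    simp at hd

/-- A consequence of the Chevalley–Warning theorem. -/
theorem exists_ne_zero_eval_eq_zero [Finite k] {σ : Type*} [Fintype σ] (F : MvPolynomial σ k)
    (h : F.totalDegree < Fintype.card σ) (h0 : eval 0 F = 0) :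
    ∃ v : σ → k, v ≠ 0 ∧ eval v F = 0 := by
  classical
  obtain ⟨p, hp⟩ := CharP.exists k
  have := Fintype.ofFinite k
  have hpp := CharP.char_is_prime k p
  -- The characteristic divides the number of zeros, and the origin is one, so there is another.
  have hdvd := char_dvd_card_solutions p h
  have h1 : 1 < Fintype.card { x : σ → k // eval x F = 0 } :=
    hpp.one_lt.trans_le (Nat.le_of_dvd (Fintype.card_pos_iff.mpr ⟨⟨0, h0⟩⟩) hdvd)
  obtain ⟨⟨v, hv⟩, hne⟩ := Fintype.exists_ne_of_one_lt_card h1 ⟨0, h0⟩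
  exact ⟨v, fun h => hne (Subtype.ext h), hv⟩

theorem exists_eq_linear {σ : Type*} [Fintype σ] {N : MvPolynomial σ k} (hN : N.totalDegree ≤ 1) :
    ∃ (c₀ : k) (c : σ → k), N = C c₀ + ∑ i, C (c i) * X i := by
  classical
  refine ⟨coeff 0 N, fun i => coeff (Finsupp.single i 1) N, ?_⟩
  ext m
  simp only [coeff_add, coeff_sum, coeff_C_mul, coeff_C]
  rcases Nat.lt_or_ge 1 m.degree with h | h
  · rw [coeff_eq_zero_of_totalDegree_lt (by
      rw [Finsupp.degree_apply] at h
      exact hN.trans_lt h)]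
    have h0 : m ≠ 0 := by
      rintro rfl
      simp at h
    rw [if_neg h0.symm, zero_add, Finset.sum_eq_zero]
    intro i _
    rw [coeff_X, if_neg, mul_zero]
    rintro rfl
    simp at h
  · obtain h | h : m.degree = 0 ∨ m.degree = 1 := by omega
    · rw [Finsupp.degree_eq_zero_iff] at h
      subst h
      simp [coeff_zero_X]
    · obtain ⟨i, rfl⟩ := (Finsupp.sum_eq_one_iff m).mp (by
        rwa [Finsupp.degree_apply] at h)
      rw [if_neg (by simp [eq_comm]), zero_add, Finset.sum_eq_single i]
      · simp
      · intro j _ hj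
        rw [coeff_X, if_neg, mul_zero]
        simpa [Finsupp.single_left_inj] using hj
      · simp

/-- Elimination of a variable by a linear equation. -/
theorem exists_elimination {m : ℕ} {c₀ : k} {c : Fin (m + 1) → k} {i : Fin (m + 1)} (hi : c i ≠ 0) :
    ∃ π : MvPolynomial (Fin (m + 1)) k →ₐ[k] MvPolynomial (Fin m) k, Function.Surjective π ∧
      RingHom.ker π = Ideal.span {C c₀ + ∑ j, C (c j) * X j} ∧
      ∀ p, (π p).totalDegree ≤ p.totalDegree := by
  let N₀ : MvPolynomial (Fin m) k := C c₀ + ∑ j, C (c (i.succAbove j)) * X j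
  have hN₀ : N₀.totalDegree ≤ 1 := by
    refine (totalDegree_add _ _).trans (max_le (by simp) (totalDegree_finsetSum_le fun j _ => ?_))
    exact (totalDegree_mul _ _).trans (by simp)
  -- The equation solved for the `i`-th variable; `s` is a section of the substitution, and `s ∘
  -- aeval w` is the identity modulo `N`.
  let w : Fin (m + 1) → MvPolynomial (Fin m) k := i.insertNth (C (-(c i)⁻¹) * N₀) X
  let s : MvPolynomial (Fin m) k →ₐ[k] MvPolynomial (Fin (m + 1)) k := rename i.succAbove
  set N : MvPolynomial (Fin (m + 1)) k := C c₀ + ∑ j, C (c j) * X j with hN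
  have hNs : N = C (c i) * X i + s N₀ := by
    rw [hN, Fin.sum_univ_succAbove _ i]
    simp [N₀, s]
    ring
  have hCC : (C (c i) : MvPolynomial (Fin m) k) * C (-(c i)⁻¹) = -1 := by
    rw [← C_mul, mul_neg, mul_inv_cancel₀ hi]
    simp
  have hCC' : (C (-(c i)⁻¹) : MvPolynomial (Fin (m + 1)) k) * C (c i) = -1 := by
    rw [← C_mul, neg_mul, inv_mul_cancel₀ hi]
    simp
  have hπs : ∀ p, aeval w (s p) = p := by
    intro p
    have : (aeval w).comp s = AlgHom.id k _ := by
      ext j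
      simp [s, w]
    exact DFunLike.congr_fun this p
  refine ⟨aeval w, fun p => ⟨s p, hπs p⟩, le_antisymm ?_ ?_, fun p => totalDegree_aeval_le _ ?_ _⟩
  · intro p hp
    have key : (Ideal.Quotient.mkₐ k (Ideal.span {N})).comp (s.comp (aeval w)) =
        Ideal.Quotient.mkₐ k (Ideal.span {N}) := by
      apply MvPolynomial.algHom_ext
      intro j
      obtain rfl | ⟨j, rfl⟩ := i.eq_self_or_eq_succAbove j
      · simp only [AlgHom.comp_apply, aeval_X, w, Fin.insertNth_apply_same]
        change Ideal.Quotient.mk _ _ = Ideal.Quotient.mk _ _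
        rw [Ideal.Quotient.mk_eq_mk_iff_sub_mem]
        refine Ideal.mem_span_singleton'.mpr ⟨C (-(c j)⁻¹), ?_⟩
        rw [hNs, map_mul]
        have : s (C (-(c j)⁻¹)) = C (-(c j)⁻¹) := s.commutes _
        rw [this]
        linear_combination hCC' * X j
      · simp [s, w]
    have h1 := DFunLike.congr_fun key p
    rw [RingHom.mem_ker] at hp
    change (Ideal.Quotient.mkₐ k _) (s (aeval w p)) = Ideal.Quotient.mk _ p at h1
    have hp' : aeval w p = 0 := hp
    rw [hp', map_zero, map_zero] at h1
    exact Ideal.Quotient.eq_zero_iff_mem.mp h1.symm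
  · rw [Ideal.span_singleton_le_iff_mem]
    change aeval w N = 0
    rw [hNs, map_add, hπs, map_mul, aeval_X]
    have : aeval w (C (c i)) = (C (c i) : MvPolynomial (Fin m) k) := (aeval w).commutes _
    rw [this]
    simp only [w, Fin.insertNth_apply_same]
    linear_combination hCC * N₀
  · intro j
    obtain rfl | ⟨j, rfl⟩ := i.eq_self_or_eq_succAbove j
    · simp only [w, Fin.insertNth_apply_same]
      exact (totalDegree_mul _ _).trans (by simpa using hN₀)
    · simp [w]

/-- A linear change of coordinates that moves the direction `v` to the first coordinate axis. -/
theorem exists_coordinate_change {m : ℕ} (v : Fin (m + 1) → k) (i : Fin (m + 1)) (hi : v i = 1) :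
    ∃ e : MvPolynomial (Fin (m + 1)) k ≃ₐ[k] MvPolynomial (Fin (m + 1)) k,
      (∀ p, (e p).totalDegree ≤ p.totalDegree) ∧
      ∀ p, Polynomial.map (aeval (0 : Fin m → k)).toRingHom (finSuccEquiv k m (e p)) =
        aeval (fun j => Polynomial.C (v j) * Polynomial.X) p := by
  let w : Fin (m + 1) → MvPolynomial (Fin (m + 1)) k :=
    -- Setting all variables but `X 0` to zero here leaves the multiples of `v`, because `v i = 1`.
    i.insertNth (X 0) fun j => X j.succ + C (v (i.succAbove j)) * X 0
  let w' : Fin (m + 1) → MvPolynomial (Fin (m + 1)) k :=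
    Fin.cons (X i) fun j => X (i.succAbove j) - C (v (i.succAbove j)) * X i
  have hC (a : k) : finSuccEquiv k m (C a) = Polynomial.C (C a) := (finSuccEquiv k m).commutes a
  let e := AlgEquiv.ofAlgHom (aeval w) (aeval w') (by
      ext1 j
      refine Fin.cases ?_ (fun j => ?_) j
      · simp [w, w']
      · simp [w, w']) (by
      ext1 j
      obtain rfl | ⟨j, rfl⟩ := i.eq_self_or_eq_succAbove j
      · simp [w, w']
      · simp [w, w'])
  refine ⟨e, fun p => totalDegree_aeval_le w ?_ p, fun p => ?_⟩
  · intro j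
    obtain rfl | ⟨j, rfl⟩ := i.eq_self_or_eq_succAbove j
    · simp [w]
    · simp only [w, Fin.insertNth_apply_succAbove]
      refine (totalDegree_add _ _).trans (max_le (by simp) ?_)
      exact (totalDegree_mul _ _).trans (by simp)
  · have key : ((Polynomial.mapAlgHom (aeval (0 : Fin m → k))).comp
        (finSuccEquiv k m).toAlgHom).comp e.toAlgHom =
        aeval (fun j => Polynomial.C (v j) * Polynomial.X) := by
      ext1 j
      obtain rfl | ⟨j, rfl⟩ := i.eq_self_or_eq_succAbove j
      · simp [e, w, hi, finSuccEquiv_X_zero]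
      · simp [e, w, hC, finSuccEquiv_X_zero, finSuccEquiv_X_succ]
    exact DFunLike.congr_fun key p

end Polynomials

/-! ### Affine quadrics with an isotropic direction. -/

section AffineQuadrics

open MvPolynomial

theorem affCls_quotient_congr {k A B : Type u} [Field k] [CommRing A] [Algebra k A]
    [Algebra.FiniteType k A] [CommRing B] [Algebra k B] [Algebra.FiniteType k B] (e : A ≃ₐ[k] B)
    (a : A) : affCls k (A ⧸ Ideal.span {a}) = affCls k (B ⧸ Ideal.span {e a}) :=
  affCls_congr (Ideal.quotientEquivAlg _ _ e (by
    rw [Ideal.map_span, Set.image_singleton]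
    rfl))

variable (k K : Type u) [Field k] [Field K] [Algebra k K] [Module.Finite k K]

/-- The classes of all affine quadrics in affine `m`-space lie in the `ℤ[𝕃]`-module generated by
`1` and `[Spec K]`. -/
def AffineQuadricsMem (m : ℕ) : Prop :=
  ∀ g : MvPolynomial (Fin m) k, g.totalDegree ≤ 2 →
    affCls k (MvPolynomial (Fin m) k ⧸ Ideal.span {g}) ∈ specSpan k K

variable {k K}

theorem affCls_hyperplane_section_mem {m : ℕ} (ih : AffineQuadricsMem k K m) {c₀ : k}
    {c : Fin (m + 1) → k} {i : Fin (m + 1)} (hi : c i ≠ 0) {h : MvPolynomial (Fin (m + 1)) k}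
    (hh : h.totalDegree ≤ 2) :
    affCls k (MvPolynomial (Fin (m + 1)) k ⧸ Ideal.span {C c₀ + ∑ j, C (c j) * X j, h}) ∈
      specSpan k K := by
  obtain ⟨π, hπ, hker, hdeg⟩ := exists_elimination (c₀ := c₀) hi
  have hsurj : Function.Surjective ((Ideal.Quotient.mkₐ k (Ideal.span {π h})).comp π) :=
    (Ideal.Quotient.mkₐ_surjective k _).comp hπ
  have hk : RingHom.ker ((Ideal.Quotient.mkₐ k (Ideal.span {π h})).comp π) =
      Ideal.span {C c₀ + ∑ j, C (c j) * X j, h} := by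
    have h1 : RingHom.ker ((Ideal.Quotient.mkₐ k (Ideal.span {π h})).comp π) =
        (Ideal.span {π h}).comap π := by
      ext p
      exact Ideal.Quotient.eq_zero_iff_mem
    have h2 : Ideal.span {π h} = (Ideal.span {h}).map π := by
      rw [Ideal.map_span, Set.image_singleton]
    rw [h1, h2, Ideal.comap_map_of_surjective' _ hπ, hker, sup_comm, ← Ideal.span_union]
    rfl
  rw [affCls_congr ((Ideal.quotientEquivAlgOfEq k hk.symm).trans
    (Ideal.quotientKerAlgEquivOfSurjective hsurj))]
  exact ih _ ((hdeg h).trans hh)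

/-- `N` may be constant: a genuine hyperplane lowers the dimension, `N = 0` leaves the quadric `h =
0`, and a nonzero constant gives the empty set. -/
theorem affCls_linear_section_mem {m : ℕ} (ih : ∀ m' ≤ m, AffineQuadricsMem k K m')
    {N h : MvPolynomial (Fin m) k} (hN : N.totalDegree ≤ 1) (hh : h.totalDegree ≤ 2) :
    affCls k (MvPolynomial (Fin m) k ⧸ Ideal.span {N, h}) ∈ specSpan k K := by
  obtain ⟨c₀, c, rfl⟩ := exists_eq_linear hN
  by_cases hc : ∃ i, c i ≠ 0
  · obtain ⟨i, hi⟩ := hc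
    obtain ⟨m, rfl⟩ : ∃ m', m = m' + 1 := ⟨m - 1, by have := i.pos; omega⟩
    exact affCls_hyperplane_section_mem (ih m (by omega)) hi hh
  · push Not at hc
    rw [show C c₀ + ∑ j, C (c j) * X j = (C c₀ : MvPolynomial (Fin m) k) by simp [hc]]
    by_cases h0 : c₀ = 0
    · rw [h0, C_0, Ideal.span_insert_zero]
      exact ih m le_rfl h hh
    · have : Ideal.span {C c₀, h} = (⊤ : Ideal (MvPolynomial (Fin m) k)) :=
        Ideal.eq_top_of_isUnit_mem _ (Ideal.subset_span (Set.mem_insert _ _))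
          ((IsUnit.mk0 c₀ h0).map C)
      have := Ideal.Quotient.subsingleton_iff.mpr this
      rw [affCls_of_subsingleton]
      exact Submodule.zero_mem _

theorem affCls_linear_mem {m : ℕ} (ih : ∀ m' ≤ m, AffineQuadricsMem k K m')
    {N h : MvPolynomial (Fin m) k} (hN : N.totalDegree ≤ 1) (hh : h.totalDegree ≤ 2) :
    affCls k (Polynomial (MvPolynomial (Fin m) k) ⧸
      Ideal.span {Polynomial.C N * Polynomial.X + Polynomial.C h}) ∈ specSpan k K := by
  rw [affCls_linear]
  refine Submodule.add_mem _ (Submodule.sub_mem _ ?_ (ih m le_rfl N (by omega)))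
    (lefschetz_mul_mem (affCls_linear_section_mem ih hN hh))
  -- The whole space is the quadric with equation `0`.
  have := ih m le_rfl 0 (by simp)
  rwa [affCls_congr ((Ideal.quotientEquivAlgOfEq k Ideal.span_singleton_zero).trans
    (AlgEquiv.quotientBot k _))] at this

/-- A quadric that has a rational point at infinity. -/
theorem affCls_mem_of_isotropic {m : ℕ} (ih : ∀ m' ≤ m, AffineQuadricsMem k K m')
    {g : MvPolynomial (Fin (m + 1)) k} (hg : g.totalDegree ≤ 2) {v : Fin (m + 1) → k} (hv : v ≠ 0)
    (h0 : eval v (homogeneousComponent 2 g) = 0) :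
    affCls k (MvPolynomial (Fin (m + 1)) k ⧸ Ideal.span {g}) ∈ specSpan k K := by
  obtain ⟨i, hi⟩ := Function.ne_iff.mp hv
  obtain ⟨e, hdeg, he⟩ := exists_coordinate_change (fun j => (v i)⁻¹ * v j) i (inv_mul_cancel₀ hi)
  have hcoeff := congrArg (Polynomial.coeff · 2) (he g)
  simp only [Polynomial.coeff_map, coeff_aeval_C_mul_X] at hcoeff
  have hscale : eval (fun j => (v i)⁻¹ * v j) (homogeneousComponent 2 g) =
      (v i)⁻¹ ^ 2 * eval v (homogeneousComponent 2 g) :=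
    aeval_mul_of_isHomogeneous (homogeneousComponent_isHomogeneous 2 g) (v i)⁻¹ v
  rw [hscale, h0, mul_zero] at hcoeff
  set G := finSuccEquiv k m (e g) with hG
  have hd (j : ℕ) (hj : G.coeff j ≠ 0) : (G.coeff j).totalDegree + j ≤ 2 :=
    (totalDegree_coeff_finSuccEquiv_add_le (e g) j hj).trans ((hdeg g).trans hg)
  have hd' (j : ℕ) : (G.coeff j).totalDegree ≤ 2 - j := by
    by_cases hj : G.coeff j = 0
    · simp [hj]
    · have := hd j hj
      omega
  -- By degree, the coefficient of the square of the first variable is a constant, and by `hcoeff`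
  -- its value is that of the quadratic part at the rescaled `v`.
  have h2 : G.coeff 2 = 0 := by
    have h1 := totalDegree_eq_zero_iff_eq_C.mp (Nat.le_zero.mp (hd' 2))
    rw [h1] at hcoeff ⊢
    have : coeff 0 (G.coeff 2) = 0 := by simpa using hcoeff
    rw [this, C_0]
  have hGeq : G = Polynomial.C (G.coeff 1) * Polynomial.X + Polynomial.C (G.coeff 0) := by
    refine Polynomial.eq_X_add_C_of_natDegree_le_one
      (Polynomial.natDegree_le_iff_coeff_eq_zero.mpr fun j hj => ?_)
    by_contra hne
    have := hd j hne
    obtain rfl : j = 2 := by omega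
    exact hne h2
  rw [affCls_quotient_congr (e.trans (finSuccEquiv k m))]
  change affCls k (_ ⧸ Ideal.span {G}) ∈ _
  rw [hGeq]
  exact affCls_linear_mem ih (hd' 1) (hd' 0)

end AffineQuadrics

/-! ### Plane conics through the origin, by blowing up. -/

section Conics

open MvPolynomial

variable {k K : Type u} [Field k] [Field K] [Algebra k K] [Module.Finite k K]

/-- The map `P → (P ⧸ I)_p`. -/
noncomputable def toQuotientAway {P : Type u} [CommRing P] [Algebra k P] (I : Ideal P) (p : P) :
    P →ₐ[k] Localization.Away (Ideal.Quotient.mk I p) :=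
  (IsScalarTower.toAlgHom k (P ⧸ I) (Localization.Away (Ideal.Quotient.mk I p))).comp
    (Ideal.Quotient.mkₐ k I)

theorem toQuotientAway_apply_self {P : Type u} [CommRing P] [Algebra k P] (I : Ideal P) (p : P) :
    IsUnit (toQuotientAway (k := k) I p p) :=
  IsLocalization.Away.algebraMap_isUnit (Ideal.Quotient.mk I p)

theorem toQuotientAway_eq_zero {P : Type u} [CommRing P] [Algebra k P] {I : Ideal P} (p : P) {x : P}
    (hx : x ∈ I) : toQuotientAway (k := k) I p x = 0 := by
  change algebraMap (P ⧸ I) (Localization.Away (Ideal.Quotient.mk I p)) (Ideal.Quotient.mk I x) = 0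
  rw [Ideal.Quotient.eq_zero_iff_mem.mpr hx, map_zero]

/-- A form of `affCls_away_eq` for hypersurfaces, with all maps given on the ambient rings. In `h₁`
and `h₂` the extension to the localization is an arbitrary one, so the inverse laws can be checked
on generators of `P` and `Q`. -/
theorem affCls_quotient_away_eq {P Q : Type u} [CommRing P] [Algebra k P] [Algebra.FiniteType k P]
    [CommRing Q] [Algebra k Q] [Algebra.FiniteType k Q] {f : P} {g : Q} {p : P} {q : Q}
    (α : P →ₐ[k] Localization.Away (Ideal.Quotient.mk (Ideal.span {g}) q))
    (β : Q →ₐ[k] Localization.Away (Ideal.Quotient.mk (Ideal.span {f}) p))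
    (hα : α f = 0) (hβ : β g = 0) (hp : IsUnit (α p)) (hq : IsUnit (β q))
    (h₁ : ∀ β' : Localization.Away (Ideal.Quotient.mk (Ideal.span {g}) q) →ₐ[k]
        Localization.Away (Ideal.Quotient.mk (Ideal.span {f}) p), β'.comp (toQuotientAway (Ideal.span {g}) q) = β →
      β'.comp α = toQuotientAway (Ideal.span {f}) p)
    (h₂ : ∀ α' : Localization.Away (Ideal.Quotient.mk (Ideal.span {f}) p) →ₐ[k]
        Localization.Away (Ideal.Quotient.mk (Ideal.span {g}) q), α'.comp (toQuotientAway (Ideal.span {f}) p) = α →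
      α'.comp β = toQuotientAway (Ideal.span {g}) q) :
    affCls k (Localization.Away (Ideal.Quotient.mk (Ideal.span {f}) p)) =
      affCls k (Localization.Away (Ideal.Quotient.mk (Ideal.span {g}) q)) := by
  have hα' : ∀ x ∈ Ideal.span {f}, α x = 0 := by
    intro x hx
    obtain ⟨y, rfl⟩ := Ideal.mem_span_singleton'.mp hx
    rw [map_mul, hα, mul_zero]
  have hβ' : ∀ x ∈ Ideal.span {g}, β x = 0 := by
    intro x hx
    obtain ⟨y, rfl⟩ := Ideal.mem_span_singleton'.mp hx
    rw [map_mul, hβ, mul_zero]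
  have hp' : IsUnit (Ideal.Quotient.liftₐ _ α hα' (Ideal.Quotient.mk _ p)) := hp
  have hq' : IsUnit (Ideal.Quotient.liftₐ _ β hβ' (Ideal.Quotient.mk _ q)) := hq
  refine affCls_away_eq _ _ (Ideal.Quotient.liftₐ _ α hα') (Ideal.Quotient.liftₐ _ β hβ') hp' hq'
    (fun z => ?_) (fun z => ?_)
  · obtain ⟨x, rfl⟩ := Ideal.Quotient.mk_surjective z
    exact DFunLike.congr_fun (h₁ (awayLift _ _ hq')
      (AlgHom.ext fun y => awayLift_algebraMap _ _ hq' (Ideal.Quotient.mk _ y))) x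
  · obtain ⟨x, rfl⟩ := Ideal.Quotient.mk_surjective z
    exact DFunLike.congr_fun (h₂ (awayLift _ _ hp')
      (AlgHom.ext fun y => awayLift_algebraMap _ _ hp' (Ideal.Quotient.mk _ y))) x

/-- The equation of a plane conic through the origin after the blow-up `(x, t) ↦ (x, t x)`. -/
theorem aeval_conic {D : Type*} [CommRing D] [Algebra k D] {g : MvPolynomial (Fin 2) k}
    (hg : g.totalDegree ≤ 2) (h0 : constantCoeff g = 0) (x t : D) :
    aeval ![x, t * x] g =
      x * (Polynomial.aeval t
        (aeval ![1, Polynomial.X] (homogeneousComponent 2 g) : Polynomial k) * x +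
        Polynomial.aeval t
        (aeval ![1, Polynomial.X] (homogeneousComponent 1 g) : Polynomial k)) := by
  have h (p : MvPolynomial (Fin 2) k) :
      Polynomial.aeval t (aeval ![1, Polynomial.X] p : Polynomial k) = aeval ![1, t] p := by
    rw [← AlgHom.comp_apply, comp_aeval]
    congr 2
    ext i
    fin_cases i <;> simp
  have hw : ![x, t * x] = fun i => x * ![1, t] i := by
    ext i
    fin_cases i <;> simp [mul_comm]
  have hs (d : ℕ) : aeval ![x, t * x] (homogeneousComponent d g) =
      x ^ d * aeval ![1, t] (homogeneousComponent d g) := by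
    rw [hw]
    exact aeval_mul_of_isHomogeneous (homogeneousComponent_isHomogeneous d g) x _
  rw [h, h]
  conv_lhs => rw [eq_sum_homogeneousComponent hg]
  have h00 : homogeneousComponent 0 g = 0 := by
    rw [homogeneousComponent_zero]
    exact congrArg C h0 |>.trans C_0
  simp only [Finset.sum_range_succ, Finset.sum_range_zero, map_add, map_zero, hs, h00]
  ring

/-- Here the hypersurface is cut by `X = 0`, the exceptional divisor of the blow-up; in
`affCls_linear` it is cut by `N = 0`. -/
theorem affCls_linear_eq_away_add (R : Type u) [CommRing R] [Algebra k R] [Algebra.FiniteType k R]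
    (N l : R) :
    affCls k (Polynomial R ⧸ Ideal.span {Polynomial.C N * Polynomial.X + Polynomial.C l}) =
      affCls k (Localization.Away (Ideal.Quotient.mk
        (Ideal.span {Polynomial.C N * Polynomial.X + Polynomial.C l}) Polynomial.X)) +
      affCls k (R ⧸ Ideal.span {l}) := by
  set b := Polynomial.C N * Polynomial.X + Polynomial.C l with hb
  let π₀ : Polynomial R →ₐ[k] R ⧸ Ideal.span {l} :=
    Polynomial.aevalTower (Ideal.Quotient.mkₐ k _) 0
  have hπ₀ : ∀ p ∈ Ideal.span {b}, π₀ p = 0 := by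
    intro p hp
    obtain ⟨q, rfl⟩ := Ideal.mem_span_singleton'.mp hp
    have : Ideal.Quotient.mk (Ideal.span {l}) l = 0 :=
      Ideal.Quotient.eq_zero_iff_mem.mpr (Ideal.mem_span_singleton_self l)
    have hl : π₀ b = 0 := by
      rw [hb]
      simp [π₀, this]
    rw [map_mul, hl, mul_zero]
  let π : (Polynomial R ⧸ Ideal.span {b}) →ₐ[k] R ⧸ Ideal.span {l} :=
    Ideal.Quotient.liftₐ _ π₀ hπ₀
  have hπ (p) : π (Ideal.Quotient.mk _ p) = π₀ p := rfl
  have hsurj : Function.Surjective π := by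
    intro y
    obtain ⟨p, rfl⟩ := Ideal.Quotient.mk_surjective y
    exact ⟨Ideal.Quotient.mk _ (Polynomial.C p), by rw [hπ]; simp [π₀]⟩
  have hker : RingHom.ker π = Ideal.span {Ideal.Quotient.mk _ Polynomial.X} := by
    apply le_antisymm
    · intro y hy
      obtain ⟨p, rfl⟩ := Ideal.Quotient.mk_surjective y
      rw [RingHom.mem_ker, hπ, ← Polynomial.divX_mul_X_add p] at hy
      have h2 : Ideal.Quotient.mk (Ideal.span {l}) (p.coeff 0) = 0 := by simpa [π₀] using hy
      obtain ⟨q, hq⟩ := Ideal.mem_span_singleton'.mp (Ideal.Quotient.eq_zero_iff_mem.mp h2)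
      refine Ideal.mem_span_singleton'.mpr
        ⟨Ideal.Quotient.mk _ (p.divX - Polynomial.C q * Polynomial.C N), ?_⟩
      rw [← map_mul, Ideal.Quotient.mk_eq_mk_iff_sub_mem]
      refine Ideal.mem_span_singleton'.mpr ⟨-Polynomial.C q, ?_⟩
      have hp : p = p.divX * Polynomial.X + Polynomial.C q * Polynomial.C l := by
        rw [← Polynomial.C_mul, hq, Polynomial.divX_mul_X_add]
      rw [hb]
      linear_combination hp
    · rw [Ideal.span_singleton_le_iff_mem, RingHom.mem_ker, hπ]
      simp [π₀]
  exact affCls_scissor _ π hsurj hker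

theorem aeval_conic_eq_zero {E : Type*} [CommRing E] [Algebra k E] {g : MvPolynomial (Fin 2) k}
    (hg : g.totalDegree ≤ 2) (h0 : constantCoeff g = 0) (γ : Polynomial (Polynomial k) →ₐ[k] E)
    (hγ : γ (Polynomial.C (aeval ![1, Polynomial.X] (homogeneousComponent 2 g) : Polynomial k) * Polynomial.X +
      Polynomial.C (aeval ![1, Polynomial.X] (homogeneousComponent 1 g) : Polynomial k)) = 0) :
    aeval ![γ Polynomial.X, γ (Polynomial.C Polynomial.X) * γ Polynomial.X] g = 0 := by
  have hγC (p : Polynomial k) : Polynomial.aeval (γ (Polynomial.C Polynomial.X)) p =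
      γ (Polynomial.C p) := by
    have : Polynomial.aeval (γ (Polynomial.C Polynomial.X)) = γ.comp Polynomial.CAlgHom := by
      ext
      simp
    exact DFunLike.congr_fun this p
  rw [aeval_conic hg h0, hγC, hγC, ← map_mul, ← map_add, hγ, mul_zero]

/-- The inverse of the blow-up sends a point with coordinates `x₀, x₁` to `(x₀, x₁ / x₀)`; the
factor `x₀` that splits off from the equation is a unit and cancels. -/
theorem aevalTower_conic_eq_zero {D : Type*} [CommRing D] [Algebra k D]
    {g : MvPolynomial (Fin 2) k} (hg : g.totalDegree ≤ 2) (h0 : constantCoeff g = 0)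
    (δ : MvPolynomial (Fin 2) k →ₐ[k] D) (hδ : δ g = 0) (hu : IsUnit (δ (X 0))) {y : D}
    (hy : y * δ (X 0) = δ (X 1)) :
    Polynomial.aevalTower (Polynomial.aeval y) (δ (X 0))
      (Polynomial.C (aeval ![1, Polynomial.X] (homogeneousComponent 2 g) : Polynomial k) *
          Polynomial.X +
        Polynomial.C (aeval ![1, Polynomial.X] (homogeneousComponent 1 g) : Polynomial k)) = 0 := by
  refine hu.mul_left_cancel ?_
  simp only [map_add, map_mul, Polynomial.aevalTower_C, Polynomial.aevalTower_X]
  rw [← aeval_conic hg h0, hy, mul_zero, ← hδ]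
  have h2 : (aeval ![δ (X 0), δ (X 1)]) = δ := by
    ext i
    fin_cases i <;> simp
  rw [h2]

theorem comp_aeval_conic {D E : Type*} [CommRing D] [Algebra k D] [CommRing E] [Algebra k E]
    (δ : MvPolynomial (Fin 2) k →ₐ[k] D) (γ : Polynomial (Polynomial k) →ₐ[k] E) (β : E →ₐ[k] D)
    {y : D} (hy : y * δ (X 0) = δ (X 1))
    (hβ : β.comp γ = Polynomial.aevalTower (Polynomial.aeval y) (δ (X 0))) :
    β.comp (aeval ![γ Polynomial.X, γ (Polynomial.C Polynomial.X) * γ Polynomial.X]) = δ := by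
  have hβ' (p) : β (γ p) = Polynomial.aevalTower (Polynomial.aeval y) (δ (X 0)) p :=
    DFunLike.congr_fun hβ p
  ext i
  fin_cases i
  · simp [hβ']
  · simp [hβ', hy]

theorem comp_aevalTower_conic {D E : Type*} [CommRing D] [Algebra k D] [CommRing E] [Algebra k E]
    (δ : MvPolynomial (Fin 2) k →ₐ[k] D) (γ : Polynomial (Polynomial k) →ₐ[k] E) (α : D →ₐ[k] E)
    (hu : IsUnit (γ Polynomial.X)) {y : D} (hy : y * δ (X 0) = δ (X 1))
    (hα : α.comp δ = aeval ![γ Polynomial.X, γ (Polynomial.C Polynomial.X) * γ Polynomial.X]) :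
    α.comp (Polynomial.aevalTower (Polynomial.aeval y) (δ (X 0))) = γ := by
  have hα' (p) : α (δ p) =
      aeval ![γ Polynomial.X, γ (Polynomial.C Polynomial.X) * γ Polynomial.X] p :=
    DFunLike.congr_fun hα p
  apply Polynomial.algHom_ext'
  · ext
    simp only [AlgHom.comp_apply, Polynomial.CAlgHom_apply, Polynomial.aevalTower_C,
      Polynomial.aeval_X]
    refine hu.mul_right_cancel ?_
    have h2 : α (δ (X 0)) = γ Polynomial.X := by simp [hα']
    rw [← h2, ← map_mul, hy, hα', h2]
    simp
  · simp [hα']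

variable [Finite k] (hK : Module.finrank k K = 2)

include hK

/-- The two equations amount to one, their greatest common divisor, which is zero or has degree at
most `2`. -/
theorem affCls_univariate_pair_mem (N l : Polynomial k) (hN : N.natDegree ≤ 2)
    (hl : l.natDegree ≤ 2) :
    affCls k (Polynomial k ⧸ Ideal.span {N, l}) ∈ specSpan k K := by
  obtain ⟨d, hd⟩ := (inferInstance : (Ideal.span {N, l}).IsPrincipal)
  change Ideal.span {N, l} = Ideal.span {d} at hd
  rw [affCls_congr (Ideal.quotientEquivAlgOfEq k hd)]
  refine affCls_univariate_mem hK d ?_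
  have h1 : d ∣ N := Ideal.mem_span_singleton.mp (hd ▸ Ideal.subset_span (by simp))
  have h2 : d ∣ l := Ideal.mem_span_singleton.mp (hd ▸ Ideal.subset_span (by simp))
  by_cases hN0 : N = 0
  · by_cases hl0 : l = 0
    · subst hN0 hl0
      have : d = 0 := by
        have : d ∈ Ideal.span {(0 : Polynomial k), 0} := hd ▸ Ideal.mem_span_singleton_self d
        simpa using this
      simp [this]
    · exact (Polynomial.natDegree_le_of_dvd h2 hl0).trans hl
  · exact (Polynomial.natDegree_le_of_dvd h1 hN0).trans hN

/-- The blow-up at the origin of a plane conic through the origin, in a chart. -/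
theorem affCls_blowup_away_mem (N l : Polynomial k) (hN : N.natDegree ≤ 2)
    (hl : l.natDegree ≤ 2) :
    affCls k (Localization.Away (Ideal.Quotient.mk
      (Ideal.span {Polynomial.C N * Polynomial.X + Polynomial.C l}) Polynomial.X)) ∈
      specSpan k K := by
  rw [eq_sub_of_add_eq (affCls_linear_eq_away_add (k := k) (Polynomial k) N l).symm,
    affCls_linear (k := k) (Polynomial k) N l, affCls_polynomial, affCls_self]
  exact Submodule.sub_mem _ (Submodule.add_mem _ (Submodule.sub_mem _
    (lefschetz_mul_mem one_mem_specSpan) (affCls_univariate_mem hK N hN))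
    (lefschetz_mul_mem (affCls_univariate_pair_mem hK N l hN hl))) (affCls_univariate_mem hK l hl)

/-- Since `g` has no constant term, `g(x, t x) = x (N(t) x + l(t))` with `N(t) = g₂(1, t)` and `l(t)
= g₁(1, t)`. Off `x = 0` the conic is therefore `N x + l = 0` with `x ≠ 0`; its part in `x = 0` is a
quadric on a line. -/
theorem affCls_conic_mem (ih : AffineQuadricsMem k K 1) {g : MvPolynomial (Fin 2) k}
    (hg : g.totalDegree ≤ 2) (h0 : constantCoeff g = 0) :
    affCls k (MvPolynomial (Fin 2) k ⧸ Ideal.span {g}) ∈ specSpan k K := by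
  set I := Ideal.span {g} with hI
  let a : MvPolynomial (Fin 2) k ⧸ I := Ideal.Quotient.mk I (X 0)
  rw [affCls_eq_away_add a]
  refine Submodule.add_mem _ ?_ ?_
  · set N : Polynomial k := aeval ![1, Polynomial.X] (homogeneousComponent 2 g) with hN
    set l : Polynomial k := aeval ![1, Polynomial.X] (homogeneousComponent 1 g) with hl
    set J := Ideal.span {Polynomial.C N * Polynomial.X + Polynomial.C l} with hJ
    let b : Polynomial (Polynomial k) ⧸ J := Ideal.Quotient.mk J Polynomial.X
    have hdeg (d : ℕ) (hd : d ≤ 2) :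
        (aeval ![1, Polynomial.X] (homogeneousComponent d g) : Polynomial k).natDegree ≤ 2 := by
      refine (aeval_natDegree_le (m := 2) (n := 1) _ ?_ _ ?_).trans (by norm_num)
      · exact (homogeneousComponent_isHomogeneous d g).totalDegree_le.trans hd
      · intro i
        fin_cases i <;> simp
    suffices h : affCls k (Localization.Away a) = affCls k (Localization.Away b) by
      rw [h]
      exact affCls_blowup_away_mem hK N l (hdeg 2 le_rfl) (hdeg 1 (by norm_num))
    let γ := toQuotientAway (k := k) J Polynomial.X
    let δ := toQuotientAway (k := k) I (X 0)
    have hγu : IsUnit (γ Polynomial.X) := toQuotientAway_apply_self _ _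
    have hδu : IsUnit (δ (X 0)) := toQuotientAway_apply_self _ _
    have hγ0 : γ (Polynomial.C N * Polynomial.X + Polynomial.C l) = 0 :=
      toQuotientAway_eq_zero _ (Ideal.mem_span_singleton_self _)
    have hδ0 : δ g = 0 := toQuotientAway_eq_zero _ (Ideal.mem_span_singleton_self _)
    obtain ⟨z, hz⟩ := hδu.exists_left_inv
    have hy : δ (X 1) * z * δ (X 0) = δ (X 1) := by rw [mul_assoc, hz, mul_one]
    refine affCls_quotient_away_eq
      (aeval ![γ Polynomial.X, γ (Polynomial.C Polynomial.X) * γ Polynomial.X])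
      (Polynomial.aevalTower (Polynomial.aeval (δ (X 1) * z)) (δ (X 0))) ?_ ?_ ?_ ?_ ?_ ?_
    · exact aeval_conic_eq_zero hg h0 γ hγ0
    · exact aevalTower_conic_eq_zero hg h0 δ hδ0 hδu hy
    · simpa using hγu
    · simpa using hδu
    · exact fun β' h => comp_aeval_conic δ γ β' hy h
    · exact fun α' h => comp_aevalTower_conic δ γ α' hγu hy h
  · have e := DoubleQuot.quotQuotEquivQuotSupₐ k I (Ideal.span {X 0})
    have hmap : Ideal.map (Ideal.Quotient.mkₐ k I) (Ideal.span {X 0}) = Ideal.span {a} := by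
      rw [Ideal.map_span, Set.image_singleton]
      rfl
    have hc : (Pi.single 0 1 : Fin 2 → k) 0 ≠ 0 := by simp
    have hX : C 0 + ∑ j, C ((Pi.single 0 1 : Fin 2 → k) j) * X j = X 0 := by
      simp [Fin.sum_univ_two]
    have h1 := affCls_hyperplane_section_mem (c₀ := 0) ih hc hg
    rw [hX] at h1
    have hsup : I ⊔ Ideal.span {X 0} = Ideal.span {X 0, g} := by
      rw [hI, sup_comm, ← Ideal.span_union]
      rfl
    rw [affCls_congr ((Ideal.quotientEquivAlgOfEq k hmap.symm).trans
      (e.trans (Ideal.quotientEquivAlgOfEq k hsup)))]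
    exact h1

end Conics

/-! ### The induction over all affine quadrics. -/

section AffineInduction

open MvPolynomial

variable {k K : Type u} [Field k] [Field K] [Algebra k K] [Module.Finite k K]

theorem eval_zero_homogeneousComponent {σ : Type*} (g : MvPolynomial σ k) (d : ℕ) (hd : d ≠ 0) :
    eval 0 (homogeneousComponent d g) = 0 := by
  rw [show (eval 0 : MvPolynomial σ k →+* k) = constantCoeff from eval_zero, constantCoeff_eq,
    coeff_homogeneousComponent]
  simp [hd.symm]

/-- Over a finite field, an affine conic has a rational point, possibly at infinity. -/
theorem exists_isotropic_or_exists_eval_eq_zero [Finite k] {g : MvPolynomial (Fin 2) k}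
    (hg : g.totalDegree ≤ 2) :
    (∃ v : Fin 2 → k, v ≠ 0 ∧ eval v (homogeneousComponent 2 g) = 0) ∨ ∃ v, eval v g = 0 := by
  -- The homogenization of `g`, with `none` as the homogenizing variable: degree at most `2` in
  -- three variables.
  let G : MvPolynomial (Option (Fin 2)) k := rename some (homogeneousComponent 2 g) +
    X none * rename some (homogeneousComponent 1 g) + C (constantCoeff g) * X none ^ 2
  have hd (d : ℕ) : (rename some (homogeneousComponent d g) :
      MvPolynomial (Option (Fin 2)) k).totalDegree ≤ d :=
    (totalDegree_rename_le _ _).trans (homogeneousComponent_isHomogeneous d g).totalDegree_le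
  have hG : G.totalDegree ≤ 2 := by
    refine (totalDegree_add _ _).trans (max_le ((totalDegree_add _ _).trans
      (max_le (hd 2) ((totalDegree_mul _ _).trans ?_))) ((totalDegree_mul _ _).trans ?_))
    · have := hd 1
      rw [totalDegree_X]
      omega
    · simp [totalDegree_X_pow]
  have hev (v : Option (Fin 2) → k) : eval v G = eval (v ∘ some) (homogeneousComponent 2 g) +
      v none * eval (v ∘ some) (homogeneousComponent 1 g) + constantCoeff g * v none ^ 2 := by
    simp [G, eval_rename]
  obtain ⟨v, hv, hv0⟩ := exists_ne_zero_eval_eq_zero G (by simpa using by omega) (by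
    rw [hev]
    change eval 0 _ + 0 * _ + _ * 0 ^ 2 = 0
    rw [eval_zero_homogeneousComponent g 2 two_ne_zero]
    simp)
  rw [hev] at hv0
  -- A zero with last coordinate `0` is a point at infinity; any other is scaled to an affine point.
  by_cases hz : v none = 0
  · refine Or.inl ⟨v ∘ some, fun h => hv ?_, by simpa [hz] using hv0⟩
    ext i
    cases i with
    | none => exact hz
    | some i => exact congrFun h i
  · refine Or.inr ⟨fun i => (v none)⁻¹ * (v ∘ some) i, ?_⟩
    have hs (d : ℕ) : eval (fun i => (v none)⁻¹ * (v ∘ some) i) (homogeneousComponent d g) =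
        (v none)⁻¹ ^ d * eval (v ∘ some) (homogeneousComponent d g) :=
      aeval_mul_of_isHomogeneous (homogeneousComponent_isHomogeneous d g) _ _
    rw [eq_sum_homogeneousComponent hg]
    simp only [Finset.sum_range_succ, Finset.sum_range_zero, map_add, map_zero, hs,
      homogeneousComponent_zero, eval_C]
    rw [← constantCoeff_eq]
    field_simp
    linear_combination hv0

/-- Translation of coordinates. -/
theorem exists_translation {σ : Type*} (v : σ → k) :
    ∃ e : MvPolynomial σ k ≃ₐ[k] MvPolynomial σ k,
      (∀ p, (e p).totalDegree ≤ p.totalDegree) ∧ ∀ p, constantCoeff (e p) = eval v p := by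
  refine ⟨AlgEquiv.ofAlgHom (aeval fun i => X i + C (v i)) (aeval fun i => X i - C (v i))
    (by ext1 i; simp) (by ext1 i; simp), fun p => totalDegree_aeval_le _ (fun i => ?_) p,
    fun p => ?_⟩
  · exact (totalDegree_add _ _).trans (by simp)
  · change constantCoeff (aeval (fun i => X i + C (v i)) p) = _
    have : (constantCoeff.comp (aeval fun i => X i + C (v i)).toRingHom) = MvPolynomial.eval v := by
      ext i <;> simp
    exact DFunLike.congr_fun this p

variable [Finite k] (hK : Module.finrank k K = 2)

include hK

theorem affineQuadricsMem (m : ℕ) : AffineQuadricsMem k K m := by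
  induction m using Nat.strong_induction_on with
  | _ m ih =>
  intro g hg
  match m with
  | 0 =>
    rw [affCls_quotient_congr (isEmptyAlgEquiv k (Fin 0))]
    refine affCls_mem_of_finrank_le_two hK _ ?_
    have := Submodule.finrank_quotient_le (R := k) (M := k)
      (Ideal.span {isEmptyAlgEquiv k (Fin 0) g})
    rw [Module.finrank_self] at this
    exact this.trans (by norm_num)
  | 1 =>
    rw [affCls_quotient_congr (uniqueAlgEquiv k (Fin 1))]
    refine affCls_univariate_mem hK _ ?_
    exact aeval_natDegree_le (m := 2) (n := 1) g hg (fun _ => Polynomial.X) (by simp)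
  | 2 =>
    obtain ⟨v, hv, hv0⟩ | ⟨v, hv⟩ := exists_isotropic_or_exists_eval_eq_zero hg
    · exact affCls_mem_of_isotropic (fun m' hm' => ih m' (by omega)) hg hv hv0
    · obtain ⟨e, hdeg, he⟩ := exists_translation v
      rw [affCls_quotient_congr e]
      exact affCls_conic_mem hK (ih 1 (by norm_num)) ((hdeg g).trans hg) ((he g).trans hv)
  | m + 3 =>
    -- The quadratic part has degree at most `2`, fewer than the `m + 3` variables.
    obtain ⟨v, hv, hv0⟩ := exists_ne_zero_eval_eq_zero (homogeneousComponent 2 g)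
      ((homogeneousComponent_isHomogeneous 2 g).totalDegree_le.trans_lt
        (by rw [Fintype.card_fin]; omega)) (eval_zero_homogeneousComponent g 2 two_ne_zero)
    exact affCls_mem_of_isotropic (fun m' hm' => ih m' (by omega)) hg hv hv0

end AffineInduction

/-! ### Coordinate rings of the standard charts and of the cells. -/

section Charts

open MvPolynomial HomogeneousLocalization

variable {k : Type u} [Field k] {n : ℕ}

/-- The coordinates of the points whose first nonzero coordinate is the `i`-th one, normalized
to `1`. -/
noncomputable def cellCoord (k : Type u) [Field k] {n : ℕ} (i j : Fin (n + 1)) :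
    MvPolynomial {j // i < j} k :=
  if h : i < j then X ⟨j, h⟩ else if j = i then 1 else 0

theorem totalDegree_cellCoord_le (i j : Fin (n + 1)) : (cellCoord k i j).totalDegree ≤ 1 := by
  unfold cellCoord
  split_ifs <;> simp

theorem cellCoord_self (i : Fin (n + 1)) : cellCoord k i i = 1 := by
  simp [cellCoord]

theorem cellCoord_of_lt {i j : Fin (n + 1)} (h : j < i) : cellCoord k i j = 0 := by
  rw [cellCoord, dif_neg h.asymm, if_neg h.ne]

theorem cellCoord_of_gt {i j : Fin (n + 1)} (h : i < j) : cellCoord k i j = X ⟨j, h⟩ := by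
  rw [cellCoord, dif_pos h]

/-- The coordinate ring of the part of the hypersurface `f = 0` where the `i`-th coordinate is the
first nonzero one. -/
noncomputable abbrev CellRing (f : MvPolynomial (Fin (n + 1)) k) (i : Fin (n + 1)) : Type u :=
  MvPolynomial {j // i < j} k ⧸ Ideal.span {aeval (cellCoord k i) f}

noncomputable abbrev toCellRing (f : MvPolynomial (Fin (n + 1)) k) (i : Fin (n + 1)) :
    MvPolynomial (Fin (n + 1)) k →ₐ[k] CellRing f i :=
  (Ideal.Quotient.mkₐ k _).comp (aeval (cellCoord k i))

theorem toCellRing_self (f : MvPolynomial (Fin (n + 1)) k) (i : Fin (n + 1)) :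
    toCellRing f i f = 0 :=
  Ideal.Quotient.eq_zero_iff_mem.mpr (Ideal.mem_span_singleton_self _)

theorem toCellRing_surjective (f : MvPolynomial (Fin (n + 1)) k) (i : Fin (n + 1)) :
    Function.Surjective (toCellRing f i) := by
  refine (Ideal.Quotient.mkₐ_surjective k _).comp fun p => ⟨rename Subtype.val p, ?_⟩
  change aeval (cellCoord k i) (rename Subtype.val p) = p
  rw [aeval_rename]
  have : aeval (cellCoord k i ∘ Subtype.val) = AlgHom.id k (MvPolynomial {j // i < j} k) := by
    ext1 j
    simp [cellCoord_of_gt j.2]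
  rw [this, AlgHom.id_apply]

/-- The universal property of the cell: a point with `i`-th coordinate `1` and all earlier ones `0`
is determined by its later coordinates, which are free. -/
theorem exists_factor_aeval_cellCoord {Q : Type*} [CommRing Q] [Algebra k Q] (i : Fin (n + 1))
    (σ : MvPolynomial (Fin (n + 1)) k →ₐ[k] Q) (h1 : σ (X i) = 1) (h0 : ∀ j < i, σ (X j) = 0) :
    ∃ ψ : MvPolynomial {j // i < j} k →ₐ[k] Q, ∀ p, ψ (aeval (cellCoord k i) p) = σ p := by
  suffices h : (aeval fun j : {j // i < j} => σ (X j.1)).comp (aeval (cellCoord k i)) = σ from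
    ⟨aeval fun j => σ (X j.1), DFunLike.congr_fun h⟩
  ext1 j
  rw [AlgHom.comp_apply, aeval_X]
  rcases lt_trichotomy i j with hj | rfl | hj
  · rw [cellCoord_of_gt hj, aeval_X]
  · rw [cellCoord_self, h1, map_one]
  · rw [cellCoord_of_lt hj, h0 j hj, map_zero]

theorem eq_zero_of_toCellRing_eq_zero {Q : Type*} [CommRing Q] [Algebra k Q]
    (f : MvPolynomial (Fin (n + 1)) k) (i : Fin (n + 1))
    (σ : MvPolynomial (Fin (n + 1)) k →ₐ[k] Q) (h1 : σ (X i) = 1) (h0 : ∀ j < i, σ (X j) = 0)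
    (hf : σ f = 0) {p : MvPolynomial (Fin (n + 1)) k} (hp : toCellRing f i p = 0) : σ p = 0 := by
  obtain ⟨ψ, hψ⟩ := exists_factor_aeval_cellCoord i σ h1 h0
  obtain ⟨q, hq⟩ := Ideal.mem_span_singleton'.mp (Ideal.Quotient.eq_zero_iff_mem.mp hp)
  change q * aeval (cellCoord k i) f = aeval (cellCoord k i) p at hq
  rw [← hψ, ← hq, map_mul, hψ, hf, mul_zero]

/-- In a chart, the cell is cut out by the earlier coordinates. The quotient of `E` by them
satisfies the conditions of the universal property, so whatever dies in the cell ring already dies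
there. -/
theorem ker_eq_span_of_comp_eq {E : Type*} [CommRing E] [Algebra k E]
    (f : MvPolynomial (Fin (n + 1)) k) (i : Fin (n + 1)) (τ : MvPolynomial (Fin (n + 1)) k →ₐ[k] E)
    (hτ : Function.Surjective τ) (φ : E →ₐ[k] CellRing f i) (h : φ.comp τ = toCellRing f i)
    (hi : τ (X i) = 1) (hf : τ f = 0) :
    RingHom.ker φ = Ideal.span ((fun j => τ (X j)) '' Set.Iio i) := by
  have hφ (p) : φ (τ p) = toCellRing f i p := DFunLike.congr_fun h p
  apply le_antisymm
  · intro z hz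
    obtain ⟨p, rfl⟩ := hτ z
    rw [RingHom.mem_ker, hφ] at hz
    refine Ideal.Quotient.eq_zero_iff_mem.mp (eq_zero_of_toCellRing_eq_zero f i
      ((Ideal.Quotient.mkₐ k (Ideal.span ((fun j => τ (X j)) '' Set.Iio i))).comp τ) ?_ ?_ ?_ hz)
    · rw [AlgHom.comp_apply, hi, map_one]
    · exact fun j hj => Ideal.Quotient.eq_zero_iff_mem.mpr
        (Ideal.subset_span (Set.mem_image_of_mem _ hj))
    · rw [AlgHom.comp_apply, hf, map_zero]
  · rw [Ideal.span_le]
    rintro _ ⟨j, hj, rfl⟩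
    change φ (τ (X j)) = 0
    rw [hφ, AlgHom.comp_apply, aeval_X, cellCoord_of_lt hj, map_zero]

variable (f : MvPolynomial (Fin (n + 1)) k) (hf : f.IsHomogeneous 2)

/-- The grading of the homogeneous coordinate ring of a quadric. -/
noncomputable abbrev quadricGrading :
    ℕ → Submodule k (MvPolynomial (Fin (n + 1)) k ⧸ (formIdeal f hf).toIdeal) :=
  quotientGrading (polyGrading k n) (formIdeal f hf)

/-- The homogeneous coordinates on a quadric. -/
noncomputable def quadricCoord (j : Fin (n + 1)) :
    MvPolynomial (Fin (n + 1)) k ⧸ (formIdeal f hf).toIdeal :=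
  Ideal.Quotient.mk _ (X j)

theorem quadricCoord_mem (j : Fin (n + 1)) : quadricCoord f hf j ∈ quadricGrading f hf 1 :=
  Submodule.mem_map_of_mem (isHomogeneous_X k j)

/-- The coordinate ring of the `i`-th standard affine chart of a quadric. -/
noncomputable abbrev ChartRing (i : Fin (n + 1)) : Type u :=
  Away (quadricGrading f hf) (quadricCoord f hf i)

/-- The `k`-structure passes through the part of degree `0`, as in `projToSpec`, so that `chartι` is
a morphism over `Spec k`. -/
noncomputable instance chartRingAlgebra (i : Fin (n + 1)) : Algebra k (ChartRing f hf i) :=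
  ((fromZeroRingHom (quadricGrading f hf) _).comp
    (algebraMap k (quadricGrading f hf 0))).toAlgebra

noncomputable def chartToLocalization (i : Fin (n + 1)) :
    ChartRing f hf i →ₐ[k] Localization.Away (quadricCoord f hf i) where
  __ := algebraMap (ChartRing f hf i) (Localization.Away (quadricCoord f hf i))
  commutes' c := by
    change val (fromZeroRingHom (quadricGrading f hf) _ (algebraMap k _ c)) = _
    exact (Localization.mk_one_eq_algebraMap _).trans (IsScalarTower.algebraMap_apply k
      (MvPolynomial (Fin (n + 1)) k ⧸ (formIdeal f hf).toIdeal) _ c).symm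

theorem chartToLocalization_injective (i : Fin (n + 1)) :
    Function.Injective (chartToLocalization f hf i) :=
  val_injective _

noncomputable def chartCoord (i j : Fin (n + 1)) : ChartRing f hf i :=
  Away.mk (quadricGrading f hf) (quadricCoord_mem f hf i) 1 (quadricCoord f hf j)
    (quadricCoord_mem f hf j)

/-- Dehomogenization `X j ↦ x_j / x_i`. Identities for it are checked after multiplication by a
power of `x_i` in the full localization, into which the chart ring embeds. -/
noncomputable def chartMap (i : Fin (n + 1)) :
    MvPolynomial (Fin (n + 1)) k →ₐ[k] ChartRing f hf i :=
  aeval (chartCoord f hf i)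

theorem mul_chartToLocalization_mk (i : Fin (n + 1)) (d : ℕ)
    (b : MvPolynomial (Fin (n + 1)) k ⧸ (formIdeal f hf).toIdeal)
    (hb : b ∈ quadricGrading f hf (d • 1)) :
    algebraMap _ (Localization.Away (quadricCoord f hf i)) (quadricCoord f hf i) ^ d *
      chartToLocalization f hf i
        (Away.mk (quadricGrading f hf) (quadricCoord_mem f hf i) d b hb) =
      algebraMap _ _ b := by
  change _ * val (Away.mk (quadricGrading f hf) (quadricCoord_mem f hf i) d b hb) = _
  rw [Away.val_mk, ← map_pow, Localization.mk_eq_mk']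
  exact IsLocalization.mk'_spec' (M := .powers (quadricCoord f hf i)) _ b ⟨_, d, rfl⟩

theorem mul_chartToLocalization_chartMap (i : Fin (n + 1)) {d : ℕ}
    {F : MvPolynomial (Fin (n + 1)) k} (hF : F.IsHomogeneous d) :
    algebraMap _ (Localization.Away (quadricCoord f hf i)) (quadricCoord f hf i) ^ d *
      chartToLocalization f hf i (chartMap f hf i F) =
      algebraMap _ _ (Ideal.Quotient.mk (formIdeal f hf).toIdeal F) := by
  rw [← AlgHom.comp_apply, chartMap, comp_aeval, ← aeval_mul_of_isHomogeneous hF]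
  have h (j) : algebraMap _ (Localization.Away (quadricCoord f hf i)) (quadricCoord f hf i) *
      chartToLocalization f hf i (chartCoord f hf i j) = algebraMap _ _ (quadricCoord f hf j) := by
    have := mul_chartToLocalization_mk f hf i 1 (quadricCoord f hf j) (quadricCoord_mem f hf j)
    rwa [pow_one] at this
  simp_rw [h]
  have h2 : aeval (fun j => algebraMap _ (Localization.Away (quadricCoord f hf i))
      (quadricCoord f hf j)) = (IsScalarTower.toAlgHom k
        (MvPolynomial (Fin (n + 1)) k ⧸ (formIdeal f hf).toIdeal)
        (Localization.Away (quadricCoord f hf i))).comp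
        (Ideal.Quotient.mkₐ k (formIdeal f hf).toIdeal) := by
    ext1 j
    rw [aeval_X]
    rfl
  exact DFunLike.congr_fun h2 F

theorem chartMap_eq_of_mul_eq (i : Fin (n + 1)) {d : ℕ} {F : MvPolynomial (Fin (n + 1)) k}
    (hF : F.IsHomogeneous d) (z : ChartRing f hf i)
    (hz : algebraMap _ (Localization.Away (quadricCoord f hf i)) (quadricCoord f hf i) ^ d *
      chartToLocalization f hf i z =
        algebraMap _ _ (Ideal.Quotient.mk (formIdeal f hf).toIdeal F)) :
    chartMap f hf i F = z := by
  refine chartToLocalization_injective f hf i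
    (((IsLocalization.Away.algebraMap_isUnit (quadricCoord f hf i)).pow d).mul_left_cancel ?_)
  rw [hz, mul_chartToLocalization_chartMap f hf i hF]

theorem chartMap_surjective (i : Fin (n + 1)) : Function.Surjective (chartMap f hf i) := by
  intro z
  obtain ⟨d, b, hb, rfl⟩ := Away.mk_surjective _ (quadricCoord_mem f hf i) z
  obtain ⟨F, hF, rfl⟩ := id hb
  rw [smul_eq_mul, mul_one] at hF
  exact ⟨F, chartMap_eq_of_mul_eq f hf i hF _ (mul_chartToLocalization_mk f hf i d _ hb)⟩

theorem chartMap_X_self (i : Fin (n + 1)) : chartMap f hf i (X i) = 1 :=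
  chartMap_eq_of_mul_eq f hf i (isHomogeneous_X k i) _ (by
    rw [map_one, mul_one, pow_one]
    rfl)

theorem chartMap_self (i : Fin (n + 1)) : chartMap f hf i f = 0 := by
  refine chartMap_eq_of_mul_eq f hf i hf _ ?_
  rw [map_zero, mul_zero, Ideal.Quotient.eq_zero_iff_mem.mpr, map_zero]
  exact Ideal.mem_span_singleton_self f

instance finiteType_chartRing (i : Fin (n + 1)) : Algebra.FiniteType k (ChartRing f hf i) :=
  Algebra.FiniteType.of_surjective (chartMap f hf i) (chartMap_surjective f hf i)

theorem exists_chartRing_to_cellRing (i : Fin (n + 1)) :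
    ∃ φ : ChartRing f hf i →ₐ[k] CellRing f i, φ.comp (chartMap f hf i) = toCellRing f i := by
  let ρ₀ : (MvPolynomial (Fin (n + 1)) k ⧸ (formIdeal f hf).toIdeal) →ₐ[k] CellRing f i :=
    Ideal.Quotient.liftₐ _ (toCellRing f i) (by
      intro a ha
      obtain ⟨q, rfl⟩ := Ideal.mem_span_singleton'.mp ha
      rw [map_mul, toCellRing_self, mul_zero])
  have hρ₀ (j) : ρ₀ (quadricCoord f hf j) = toCellRing f i (X j) := rfl
  have h1 : ρ₀ (quadricCoord f hf i) = 1 := by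
    rw [hρ₀, AlgHom.comp_apply, aeval_X, cellCoord_self, map_one]
  let ρ := awayLift (quadricCoord f hf i) ρ₀ (h1 ▸ isUnit_one)
  have hρ (b) : ρ (algebraMap _ _ b) = ρ₀ b := awayLift_algebraMap _ _ _ _
  refine ⟨ρ.comp (chartToLocalization f hf i), ?_⟩
  ext1 j
  have h2 := congrArg ρ (mul_chartToLocalization_chartMap f hf i (isHomogeneous_X k j))
  rw [pow_one, map_mul, hρ, hρ, h1, one_mul] at h2
  exact h2

end Charts

/-! ### The charts as an open cover of the quadric, and its cells. -/

section ChartMaps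

open MvPolynomial HomogeneousLocalization

variable {k : Type u} [Field k] {n : ℕ} (f : MvPolynomial (Fin (n + 1)) k)
  (hf : f.IsHomogeneous 2)

/-- The inclusion of the `i`-th standard affine chart into a quadric. -/
noncomputable def chartι (i : Fin (n + 1)) : specVariety k (ChartRing f hf i) ⟶ quadric f hf :=
  ObjectProperty.homMk (Over.homMk (Proj.awayι (quadricGrading f hf) (quadricCoord f hf i)
    (quadricCoord_mem f hf i) one_pos) (by
      change Proj.awayι (quadricGrading f hf) (quadricCoord f hf i)
        (quadricCoord_mem f hf i) one_pos ≫ Proj.toSpecZero (quadricGrading f hf) ≫ Spec.map _ =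
          Spec.map _
      rw [Proj.awayι_toSpecZero_assoc, ← Spec.map_comp, ← CommRingCat.ofHom_comp]))

theorem mem_range_chartι_iff (i : Fin (n + 1)) (x : Proj (quadricGrading f hf)) :
    x ∈ Set.range (chartι f hf i).hom.left ↔
      x ∈ Proj.basicOpen (quadricGrading f hf) (quadricCoord f hf i) := by
  rw [← Proj.opensRange_awayι _ _ (quadricCoord_mem f hf i) one_pos]
  rfl

theorem adjoin_range_quadricCoord :
    Algebra.adjoin (quadricGrading f hf 0) (Set.range (quadricCoord f hf)) = ⊤ := by
  rw [eq_top_iff]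
  rintro b -
  obtain ⟨p, rfl⟩ := Ideal.Quotient.mk_surjective b
  induction p using MvPolynomial.induction_on with
  | C c =>
    exact Subalgebra.algebraMap_mem _ (algebraMap k (quadricGrading f hf 0) c)
  | add p q hp hq =>
    rw [map_add]
    exact add_mem hp hq
  | mul_X p j hp =>
    rw [map_mul]
    exact mul_mem hp (Algebra.subset_adjoin ⟨j, rfl⟩)

theorem exists_mem_range_chartι (x : (quadric f hf).obj.left) :
    ∃ i, x ∈ Set.range (chartι f hf i).hom.left := by
  have h := Proj.iSup_basicOpen_eq_top' (quadricGrading f hf) (quadricCoord f hf)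
    (fun i => ⟨1, quadricCoord_mem f hf i⟩) (adjoin_range_quadricCoord f hf)
  obtain ⟨i, hi⟩ := TopologicalSpace.Opens.mem_iSup.mp (h.ge (Set.mem_univ x))
  exact ⟨i, (mem_range_chartι_iff f hf i x).mpr hi⟩

theorem chartι_mem_range_iff (i j : Fin (n + 1))
    (x : (specVariety k (ChartRing f hf i)).obj.left) :
    (chartι f hf i).hom.left x ∈ Set.range (chartι f hf j).hom.left ↔
      chartCoord f hf i j ∉ PrimeSpectrum.asIdeal (R := ChartRing f hf i) x := by
  have h := Proj.awayι_preimage_basicOpen (quadricGrading f hf) (quadricCoord_mem f hf i) one_pos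
    (quadricCoord_mem f hf j) one_pos
  have h1 : Away.isLocalizationElem (quadricCoord_mem f hf i) (quadricCoord_mem f hf j) =
      chartCoord f hf i j := by
    unfold chartCoord Away.isLocalizationElem
    congr 1
    exact pow_one _
  rw [h1] at h
  exact (mem_range_chartι_iff f hf j _).trans (SetLike.ext_iff.mp h x)

theorem range_specHom_of_surjective {A B : Type u} [CommRing A] [CommRing B] [Algebra k A]
    [Algebra k B] [Algebra.FiniteType k A] [Algebra.FiniteType k B] (φ : A →ₐ[k] B)
    (hφ : Function.Surjective φ) : Set.range (specHom φ).hom.left =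
      (PrimeSpectrum.zeroLocus (RingHom.ker φ : Set A) : Set (PrimeSpectrum A)) :=
  range_comap_of_surjective _ _ hφ

/-- Lying outside the `j`-th chart means `x_j / x_i = 0`, so `T` and the cell have the same points
in the chart, and the class of a closed subvariety depends only on its points. -/
theorem cls_cell_eq (i : Fin (n + 1)) (T : Variety k) (t : T ⟶ specVariety k (ChartRing f hf i))
    (ht : IsClosedImmersion t.hom.left)
    (hrange : Set.range t.hom.left = {u | ∀ j < i,
      (chartι f hf i).hom.left u ∉ Set.range (chartι f hf j).hom.left}) :
    cls T = affCls k (CellRing f i) := by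
  obtain ⟨φ, hφ⟩ := exists_chartRing_to_cellRing f hf i
  have hsurj : Function.Surjective φ := by
    have := toCellRing_surjective f i
    rw [← hφ] at this
    exact .of_comp this
  refine cls_eq_of_range_eq t (specHom φ) ht (IsClosedImmersion.spec_of_surjective _ hsurj) ?_
  rw [range_specHom_of_surjective φ hsurj, ker_eq_span_of_comp_eq f i (chartMap f hf i)
    (chartMap_surjective f hf i) φ hφ (chartMap_X_self f hf i) (chartMap_self f hf i),
    PrimeSpectrum.zeroLocus_span, hrange]
  ext x
  refine Iff.trans ?_ Set.image_subset_iff.symm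
  refine forall₂_congr fun j _ => ?_
  rw [chartι_mem_range_iff, not_not]
  change _ ↔ chartMap f hf i (X j) ∈ PrimeSpectrum.asIdeal (R := ChartRing f hf i) x
  rw [chartMap, aeval_X]

end ChartMaps

/-! ### Assembly, and the quadratic extension. -/

section Main

open MvPolynomial

variable {k K : Type u} [Field k] [Finite k] [Field K] [Algebra k K] [Module.Finite k K]

theorem affCls_cellRing_mem (hK : Module.finrank k K = 2) {n : ℕ}
    {f : MvPolynomial (Fin (n + 1)) k} (hf : f.totalDegree ≤ 2) (i : Fin (n + 1)) :
    affCls k (CellRing f i) ∈ specSpan k K := by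
  let e := Fintype.equivFin {j // i < j}
  rw [affCls_quotient_congr (renameEquiv k e)]
  refine affineQuadricsMem hK _ _ ?_
  exact (totalDegree_rename_le _ _).trans
    ((totalDegree_aeval_le _ (totalDegree_cellCoord_le i) f).trans hf)

theorem cls_quadric_mem (hK : Module.finrank k K = 2) {n : ℕ}
    (f : MvPolynomial (Fin (n + 1)) k) (hf : f.IsHomogeneous 2) :
    cls (quadric f hf) ∈ specSpan k K := by
  refine cls_mem_of_forall_closed (specSpan k K).toAddSubgroup (quadric f hf) _ (chartι f hf)
    (fun i => inferInstanceAs (IsOpenImmersion (Proj.awayι _ _ _ _)))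
    (exists_mem_range_chartι f hf) fun i T t ht hrange => ?_
  rw [cls_cell_eq f hf i T t ht hrange]
  exact affCls_cellRing_mem hK hf.totalDegree_le i

theorem exists_quadratic_extension (k : Type u) [Field k] [Finite k] :
    ∃ (K : Type u) (_ : Field K) (_ : Algebra k K) (_ : Module.Finite k K),
      Module.finrank k K = 2 := by
  obtain ⟨p, hp⟩ := CharP.exists k
  have : Fact p.Prime := ⟨CharP.char_is_prime k p⟩
  -- `ULift` brings the extension into the universe of `k`, as `specVariety` demands.
  let e : ULift.{u} (FiniteField.Extension k p 2) ≃ₐ[k] FiniteField.Extension k p 2 :=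
    ULift.algEquiv
  exact ⟨ULift.{u} (FiniteField.Extension k p 2), inferInstance, inferInstance,
    Module.Finite.equiv e.symm.toLinearEquiv,
    e.toLinearEquiv.finrank_eq.trans (FiniteField.finrank_extension k p 2)⟩

end Main

end GrothendieckRing

theorem mainTheorem11 {k : Type u} [Field k] [Finite k] (n : ℕ) (hn : 1 ≤ n)
    (f : MvPolynomial (Fin (n + 1)) k) (hf : f.IsHomogeneous 2) (hf0 : f ≠ 0) :
    ∃ (K : Type u) (_ : Field K) (_ : Algebra k K) (_ : Module.Finite k K),
      Module.finrank k K ≤ 2 ∧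
      GrothendieckRing.cls (GrothendieckRing.quadric f hf) ∈
        Submodule.span (GrothendieckRing.ZL k)
          ({1, GrothendieckRing.cls (GrothendieckRing.specVariety k K)} :
            Set (GrothendieckRing.K0 k)) := by
  obtain ⟨K, hK, hkK, hfin, h2⟩ := GrothendieckRing.exists_quadratic_extension k
  exact ⟨K, hK, hkK, hfin, h2.le, GrothendieckRing.cls_quadric_mem h2 f hf⟩
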